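/- **Setting.** Let $M\in\mathbb{R}^{n\times n}$ be symmetric, $d\in\mathbb{R}^n$, $A\in\mathbb{R}^{m\times n}$, $b\in\mathbb{R}^m$, $\gamma>0$, let $g:\mathbb{R}^n\to\mathbb{R}$ be convex and continuously differentiable, and put $f_Q(x)=x^TMx+d^Tx$, $f=f_Q+g$. All norms are Euclidean and $e=(1;\dots;1)$. Consider $$(\mathcal{P}_{\rm rel})\quad \min\ f(x^+-x^-)+\gamma e^T(e-\xi)\quad\text{s.t. } (x^++x^-)^T\xi=0,\ x^+,x^-\ge 0,\ 0\le\xi\le e,\ A(x^+-x^-)\ge b .$$ A point $(x^+;x^-;\xi)$ satisfies the first-order KKT conditions of $(\mathcal{P}_{\rm rel})$ if there are $\mu\in\mathbb{R}$, $\beta_1,\dots,\beta_4\in\mathbb{R}^n$, $\pi\in\mathbb{R}^m$ with $$\nabla f(x^+-x^-)+\mu\xi-\beta_1-A^T\pi=0,\quad -\nabla f(x^+-x^-)+\mu\xi-\beta_2+A^T\pi=0,\quad -\gamma e+\mu(x^++x^-)+\beta_4-\beta_3=0,$$ $0\le\beta_1\perp x^+\ge0$, $0\le\beta_2\perp x^-\ge0$,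 $0\le\beta_3\perp\xi\ge0$, $0\le\beta_4\perp e-\xi\ge0$, $0\le\pi\perp A(x^+-x^-)-b\ge0$ and $(x^++x^-)^T\xi=0$. For $w=(x^+;x^-;\xi)$ and $y=(y^+;y^-;\zeta)$ in $\mathbb{R}^{3n}$ let $Z_1=\{w:(x^++x^-)^T\xi=0\}$, $Z_2=\{w: 0\le\xi\le e,\ x^\pm\ge0,\ A(x^+-x^-)\ge b\}$, $h(w)=f_Q(x^+-x^-)+\gamma\sum_i(1-\xi_i)$, $p(y)=g(y^+-y^-)$, $$\mathcal{L}(w,y,\lambda,\rho)=h(w)+p(y)+\lambda^T(w-y)+\tfrac{\rho}{2}\|w-y\|^2,$$ $$\mathcal{H}_\rho(w,y,\lambda)=\mathcal{L}(w,y,\lambda,\rho)+\mathbf{1}_{Z_1}(w)+\mathbf{1}_{Z_2}(y),$$ where $\mathbf{1}_Z$ is $0$ on $Z$ and $+\infty$ elsewhere. **The scheme ADMM$_{\rm cf}$.** Let $\delta_\rho>1$, $\rho_0>0$ with $\rho_0I+4M\succ0$, $0<\delta<\rho_0<\rho_{\max}$, and let $y_0,\lambda_0\in\mathbb{R}^{3n}$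 be arbitrary. For $k\ge0$, $$w_{k+1}\in\operatorname*{argmin}_{w\in Z_1}\mathcal{L}(w,y_k,\lambda_k,\rho_k),\quad y_{k+1}=\operatorname*{argmin}_{y\in Z_2}\mathcal{L}(w_{k+1},y,\lambda_k,\rho_k),\quad \lambda_{k+1}=\lambda_k+\rho_k(w_{k+1}-y_{k+1}),$$ and $\rho_{k+1}=\delta_\rho\rho_k$ if $(\rho_k-\delta)\|y_{k+1}-y_k\|<\sqrt2\,\|\lambda_{k+1}-\lambda_k\|$ and $\rho_k\le\rho_{\max}$, while $\rho_{k+1}=\rho_k$ otherwise. (The point $w_0$ is arbitrary and is not used by the scheme.) **K-L property.** For $F:\mathbb{R}^N\to\mathbb{R}\cup\{+\infty\}$ let $\partial F$ be the limiting subdifferential. $F$ has the K-L property at $\bar x$ if $\partial F(\bar x)\neq\emptyset$ and there are $\eta\in(0,\infty)$, a neighborhood $U$ of $\bar x$ and a continuous concave $\phi:[0,\eta)\to\mathbb{R}_+$ with $\phi(0)=0$, $\phi$ of class $C^1$ with $\phi'>0$ on $(0,\eta)$, such that $\phi'(F(x)-F(\bar x))\,\mathrm{dist}(0,\partial F(x))\ge1$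 for all $x\in U$ with $F(\bar x)<F(x)<F(\bar x)+\eta$ (where $\mathrm{dist}(0,\emptyset)=+\infty$). **Theorem.** Let $\{(w_k,y_k,\lambda_k,\rho_k)\}_{k\ge0}$ be an infinite sequence generated by ADMM$_{\rm cf}$. Suppose that $\rho_k\le\rho_{\max}$ for all $k$, that $\liminf_{k\to\infty}\|\lambda_k\|<\infty$, and that $\{y_k\}$ is bounded. Then there are $K_0\in\mathbb{N}$ and $\rho\in\mathbb{R}$ such that, with $C=(\rho-\delta)/\sqrt2$, the following hold. 1. For all $k\ge K_0$, $\rho_k=\rho$ and $\|\lambda_{k+1}-\lambda_k\|\le C\|y_{k+1}-y_k\|$. 2. $\{\mathcal{L}(w_k,y_k,\lambda_k,\rho_k)\}_{k\ge K_0}$ is non-increasing, and for all $k\ge K_0$ $$\mathcal{L}(w_{k+1},y_{k+1},\lambda_{k+1},\rho)-\mathcal{L}(w_k,y_k,\lambda_k,\rho)\le\Big(\frac{C^2}{\rho}-\frac{\rho}{2}\Big)\|y_{k+1}-y_k\|^2\le-\frac{\delta}{2}\|y_{k+1}-y_k\|^2 .$$ 3. $\{\mathcal{L}(w_k,y_k,\lambda_k,\rho_k)\}_{k\ge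 K_0}$ is bounded from below, $y_{k+1}-y_k\to0$, $y_k-w_k\to0$, $\{w_k\}$ is bounded, and $\{(w_k;y_k;\lambda_k)\}$ has a convergent subsequence. 4. Let $z^*=(w^*;y^*;\lambda^*)$ be the limit of any convergent subsequence of $\{(w_k;y_k;\lambda_k)\}$, and suppose that $\mathcal{H}_\rho$ has the K-L property at $z^*$. Then $\sum_{k=0}^\infty\|y_{k+1}-y_k\|<\infty$, the whole sequence $(w_k;y_k;\lambda_k)$ converges to $z^*$, and $w^*$ satisfies the first-order KKT conditions of $(\mathcal{P}_{\rm rel})$. -/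

import Mathlib

open Filter Topology Set
open scoped Matrix

noncomputable section

/-- The space `ℝⁿ` with its Euclidean norm. -/
abbrev Vec (n : ℕ) := EuclideanSpace ℝ (Fin n)

/-- Stacked triples `(a; b; c)` of vectors, with the Euclidean (`ℓ²`) norm and inner product;
the three blocks of `u` are `u 0`, `u 1`, `u 2`. -/
abbrev Triple (E : Type) := PiLp 2 (fun _ : Fin 3 => E)

/-- The space of points `w = (x⁺; x⁻; ξ)` with `x⁺, x⁻, ξ ∈ ℝⁿ`. -/
abbrev Pt (n : ℕ) := Triple (Vec n)

/-! ### Extended-valued functions, limiting subdifferential, Kurdyka-Lojasiewicz property -/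

section Variational

variable {E : Type} [NormedAddCommGroup E] [InnerProductSpace ℝ E]

open Classical in
/-- The indicator function of a set `Z`: `0` on `Z` and `+∞` elsewhere. -/
def indicatorFn (Z : Set E) (z : E) : EReal := if z ∈ Z then 0 else ⊤

/-- The Fréchet subdifferential: `v ∈ ∂̂F(x)` iff `F x` is finite and
`liminf_{y → x, y ≠ x} (F y - F x - ⟪v, y - x⟫) / ‖y - x‖ ≥ 0` (written with `ε`). -/
def frechetSubdiff (F : E → EReal) (x : E) : Set E :=
  {v | F x ≠ ⊤ ∧ F x ≠ ⊥ ∧ ∀ ε : ℝ, 0 < ε → ∀ᶠ y in 𝓝 x,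
    (((F x).toReal + inner ℝ v (y - x) - ε * ‖y - x‖ : ℝ) : EReal) ≤ F y}

/-- The limiting subdifferential `∂F(x)`: limits of Fréchet subgradients `qⱼ ∈ ∂̂F(uⱼ)` along
sequences `uⱼ → x` with `F(uⱼ) → F(x)`; empty where `F x` is not finite. -/
def limitingSubdiff (F : E → EReal) (x : E) : Set E :=
  {v | F x ≠ ⊤ ∧ F x ≠ ⊥ ∧ ∃ u q : ℕ → E,
    Tendsto u atTop (𝓝 x) ∧ Tendsto (fun j => F (u j)) atTop (𝓝 (F x)) ∧
    (∀ j, q j ∈ frechetSubdiff F (u j)) ∧ Tendsto q atTop (𝓝 v)}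

/-- The Kurdyka-Lojasiewicz property of `F` at a point `xbar` of `dom ∂F`. The distance
`dist(0, ∂F(x))` is `+∞` when `∂F(x)` is empty. -/
def HasKLPropertyAt (F : E → EReal) (xbar : E) : Prop :=
  (limitingSubdiff F xbar).Nonempty ∧
  ∃ η : ℝ, 0 < η ∧ ∃ U ∈ 𝓝 xbar, ∃ φ : ℝ → ℝ,
    ContinuousOn φ (Ico 0 η) ∧ ConcaveOn ℝ (Ico 0 η) φ ∧ (∀ s ∈ Ico 0 η, 0 ≤ φ s) ∧
    φ 0 = 0 ∧ ContDiffOn ℝ 1 φ (Ioo 0 η) ∧ (∀ s ∈ Ioo 0 η, 0 < deriv φ s) ∧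
    ∀ x ∈ U, F xbar < F x → F x < F xbar + (η : EReal) →
      1 ≤ ENNReal.ofReal (deriv φ (F x - F xbar).toReal) *
        Metric.infEDist 0 (limitingSubdiff F x)

end Variational

/-! ### The relaxed complementarity problem

`min f(x⁺ - x⁻) + γ eᵀ(e - ξ)` subject to `(x⁺ + x⁻)ᵀ ξ = 0`, `x⁺, x⁻ ≥ 0`, `0 ≤ ξ ≤ e`,
`A (x⁺ - x⁻) ≥ b`, where `f x = xᵀ M x + dᵀ x + g x`. -/

/-- The data of the problem. -/
structure ProblemData (n m : ℕ) where
  M : Matrix (Fin n) (Fin n) ℝ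
  d : Fin n → ℝ
  g : Vec n → ℝ
  γ : ℝ
  A : Matrix (Fin m) (Fin n) ℝ
  b : Fin m → ℝ

/-- The relation `0 ≤ a ⊥ c ≥ 0` between two vectors. -/
def Complementary {ι : Type} (a c : ι → ℝ) : Prop :=
  (∀ i, 0 ≤ a i) ∧ (∀ i, 0 ≤ c i) ∧ ∀ i, a i * c i = 0

namespace ProblemData

variable {n m : ℕ} (P : ProblemData n m)

/-- The quadratic part `f_Q x = xᵀ M x + dᵀ x`. -/
def fQ (x : Vec n) : ℝ := x.ofLp ⬝ᵥ (P.M *ᵥ x.ofLp) + P.d ⬝ᵥ x.ofLp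

/-- The loss `f = f_Q + g`. -/
def f (x : Vec n) : ℝ := P.fQ x + P.g x

/-- `Z₁ = {(x⁺; x⁻; ξ) : (x⁺ + x⁻)ᵀ ξ = 0}`. -/
def Z₁ (_P : ProblemData n m) : Set (Pt n) := {w | inner ℝ (w 0 + w 1) (w 2) = 0}

/-- `Z₂ = {(x⁺; x⁻; ξ) : 0 ≤ ξ ≤ e, x⁺ ≥ 0, x⁻ ≥ 0, A (x⁺ - x⁻) ≥ b}`. -/
def Z₂ : Set (Pt n) :=
  {w | (∀ i, 0 ≤ w 2 i ∧ w 2 i ≤ 1) ∧ (∀ i, 0 ≤ w 0 i) ∧ (∀ i, 0 ≤ w 1 i) ∧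
    ∀ j, P.b j ≤ (P.A *ᵥ (w 0 - w 1).ofLp) j}

/-- `h w = f_Q (x⁺ - x⁻) + γ ∑ᵢ (1 - ξᵢ)`. -/
def h (w : Pt n) : ℝ := P.fQ (w 0 - w 1) + P.γ * ∑ i, (1 - w 2 i)

/-- `p y = g (y⁺ - y⁻)`. -/
def p (y : Pt n) : ℝ := P.g (y 0 - y 1)

/-- The augmented Lagrangian without indicator functions,
`L(w, y, λ, ρ) = h w + p y + λᵀ (w - y) + (ρ / 2) ‖w - y‖²`. -/
def augLag (w y lam : Pt n) (ρ : ℝ) : ℝ :=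
  P.h w + P.p y + inner ℝ lam (w - y) + ρ / 2 * ‖w - y‖ ^ 2

/-- The extended-valued function `H_ρ(w; y; λ) =
h w + 1_{Z₁}(w) + p y + 1_{Z₂}(y) + λᵀ (w - y) + (ρ / 2) ‖w - y‖²` of `z = (w; y; λ)`. -/
def H (ρ : ℝ) (z : Triple (Pt n)) : EReal :=
  (P.augLag (z 0) (z 1) (z 2) ρ : EReal) + indicatorFn P.Z₁ (z 0) + indicatorFn P.Z₂ (z 1)

/-- The first-order KKT conditions of the relaxed complementarity problem at
`w = (x⁺; x⁻; ξ)`. -/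
def IsKKT (w : Pt n) : Prop :=
  ∃ (μ : ℝ) (β₁ β₂ β₃ β₄ : Fin n → ℝ) (π : Fin m → ℝ),
    (∀ i, gradient P.f (w 0 - w 1) i + μ * w 2 i - β₁ i - (P.Aᵀ *ᵥ π) i = 0) ∧
    (∀ i, -gradient P.f (w 0 - w 1) i + μ * w 2 i - β₂ i + (P.Aᵀ *ᵥ π) i = 0) ∧
    (∀ i, -P.γ + μ * (w 0 i + w 1 i) + (β₄ i - β₃ i) = 0) ∧
    Complementary β₁ (fun i => w 0 i) ∧
    Complementary β₂ (fun i => w 1 i) ∧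
    Complementary β₃ (fun i => w 2 i) ∧
    Complementary β₄ (fun i => 1 - w 2 i) ∧
    Complementary π (fun j => (P.A *ᵥ (w 0 - w 1).ofLp) j - P.b j) ∧
    inner ℝ (w 0 + w 1) (w 2) = 0

end ProblemData

/-- The sequence `(w_k, y_k, λ_k, ρ_k)` is generated by the scheme with parameters
`δ`, `δρ`, `ρmax`, started from arbitrary `y 0`, `lam 0` and an admissible `ρ 0`. The first
iterate for `w` is `w 1`; the scheme never uses `w 0`, which is unconstrained here. Minimizing the
augmented Lagrangian with `(ρ / 2) ‖w - y + λ / ρ‖²` and indicator functions amounts to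
minimizing `augLag` over `Z₁`, respectively `Z₂`. The stopping test is not part of the infinite
sequence. -/
structure IsADMMSequence {n m : ℕ} (P : ProblemData n m) (δ δρ ρmax : ℝ)
    (w y lam : ℕ → Pt n) (ρ : ℕ → ℝ) : Prop where
  one_lt_δρ : 1 < δρ
  ρ_zero_pos : 0 < ρ 0
  ρ_zero_posDef : (ρ 0 • (1 : Matrix (Fin n) (Fin n) ℝ) + (4 : ℝ) • P.M).PosDef
  δ_pos : 0 < δ
  δ_lt : δ < ρ 0
  lt_ρmax : ρ 0 < ρmax
  w_mem : ∀ k, w (k + 1) ∈ P.Z₁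
  w_min : ∀ k, ∀ w' ∈ P.Z₁,
    P.augLag (w (k + 1)) (y k) (lam k) (ρ k) ≤ P.augLag w' (y k) (lam k) (ρ k)
  y_mem : ∀ k, y (k + 1) ∈ P.Z₂
  y_min : ∀ k, ∀ y' ∈ P.Z₂,
    P.augLag (w (k + 1)) (y (k + 1)) (lam k) (ρ k) ≤ P.augLag (w (k + 1)) y' (lam k) (ρ k)
  lam_succ : ∀ k, lam (k + 1) = lam k + ρ k • (w (k + 1) - y (k + 1))
  ρ_succ : ∀ k, ρ (k + 1) =
    if (ρ k - δ) * ‖y (k + 1) - y k‖ < √2 * ‖lam (k + 1) - lam k‖ ∧ ρ k ≤ ρmax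
    then δρ * ρ k else ρ k

end

/-! The penalty is multiplied by a fixed factor greater than 1 at each increase, so boundedness
allows finitely many increases (`eventually_const_of_bounded_increase`). Afterwards the test always
fails, which says exactly that `‖Δλ‖ ≤ C ‖Δy‖`.

One sweep then has a simple energy balance (`augLag_succ_le`). The `w`-step does not increase the
augmented Lagrangian. The `y`-step, a convex problem with a squared distance added, lowers it by at
least `(ρ/2) ‖Δy‖²`. The multiplier step raises it by `‖Δλ‖² / ρ`. The choice of `C` makes the net
change at most `-(δ/2) ‖Δy‖²`. A bounded subsequence of multipliers yields a cluster point, and by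
continuity the monotone energies converge to the value there, so `Δy → 0`. Since `w - y = Δλ / ρ`,
the primal gap vanishes too.

For convergence of the whole sequence, no subdifferential calculus on the nonconvex set `Z₁` is
needed. Adding the two global minimality inequalities of a sweep gives a quadratic lower bound for
`H` at the new iterate, hence an explicit Fréchet subgradient of size `O(‖Δy‖)`
(`mem_frechetSubdiff`). With sufficient decrease, this feeds the usual Kurdyka-Lojasiewicz length
argument (`summable_of_desingularizing`).

Both minimality properties survive in the limit, where `w* = y*`. On `Z₂` they give multipliers by
Farkas' lemma. On `Z₁` no constraint qualification is available when `x⁺ + x⁻` and `ξ` both vanish,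
but `Z₁` contains enough straight lines through the point to force the multiplier
(`exists_multiplier_of_lines`). Adding the two systems eliminates `λ*` and leaves the KKT
conditions. -/

/-! ### Farkas' lemma and polyhedral optimality conditions -/

/-- **Farkas' lemma**: a linear functional that is nonnegative wherever finitely many given
functionals are nonnegative is a conic combination of them. -/
theorem farkas_linear {ι V : Type*} [AddCommGroup V] [Module ℝ V] (s : Finset ι) :
    ∀ (a : ι → V →ₗ[ℝ] ℝ) (c : V →ₗ[ℝ] ℝ), (∀ x, (∀ i ∈ s, 0 ≤ a i x) → 0 ≤ c x) →
      ∃ μ : ι → ℝ, (∀ i, 0 ≤ μ i) ∧ c = ∑ i ∈ s, μ i • a i := by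
  classical
  induction s using Finset.induction_on with
  | empty =>
    intro a c h
    refine ⟨0, fun _ => le_rfl, ?_⟩
    ext x
    have h1 := h x (by simp)
    have h2 := h (-x) (by simp)
    rw [map_neg] at h2
    simp only [Finset.sum_empty, LinearMap.zero_apply]
    linarith
  | insert j s hj ih =>
    intro a c h
    by_cases hc : ∀ x, (∀ i ∈ s, 0 ≤ a i x) → 0 ≤ c x
    · obtain ⟨μ, hμ, rfl⟩ := ih a c hc
      refine ⟨Function.update μ j 0, fun i => ?_, ?_⟩
      · by_cases hi : i = j
        · subst hi; simp
        · simp [hi, hμ i]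
      · rw [Finset.sum_insert hj]
        simp only [Function.update_self, zero_smul, zero_add]
        refine Finset.sum_congr rfl fun i hi => ?_
        rw [Function.update_of_ne (ne_of_mem_of_not_mem hi hj)]
    · push Not at hc
      obtain ⟨x₁, hx₁, hcx₁⟩ := hc
      have hjx₁ : a j x₁ < 0 := by
        by_contra hcon
        push Not at hcon
        refine absurd (h x₁ fun i hi => ?_) (not_le.2 hcx₁)
        rcases Finset.mem_insert.1 hi with rfl | hi
        · exact hcon
        · exact hx₁ i hi
      obtain ⟨x₀, hx₀, hcx₀, hjx₀⟩ :
          ∃ x₀, (∀ i ∈ s, 0 ≤ a i x₀) ∧ c x₀ < 0 ∧ a j x₀ = -1 := by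
        have hpos : 0 < (-a j x₁)⁻¹ := inv_pos.2 (by linarith)
        refine ⟨(-a j x₁)⁻¹ • x₁, fun i hi => ?_, ?_, ?_⟩
        · rw [map_smul, smul_eq_mul]; exact mul_nonneg hpos.le (hx₁ i hi)
        · rw [map_smul, smul_eq_mul]; exact mul_neg_of_pos_of_neg hpos hcx₁
        · rw [map_smul, smul_eq_mul, inv_neg, neg_mul, inv_mul_cancel₀ hjx₁.ne]
      -- Projection onto `ker (a j)` along `x₀`. The constraint `j` holds automatically on its
      -- range, so the induction hypothesis applies to the functionals composed with `T`; undoing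
      -- the composition produces the coefficient of `a j` below.
      let T : V →ₗ[ℝ] V := LinearMap.id + (a j).smulRight x₀
      have hT : ∀ x, T x = x + a j x • x₀ := fun x => rfl
      obtain ⟨μ, hμ, hceq⟩ := ih (fun i => (a i).comp T) (c.comp T) (by
        intro x hx
        refine h (T x) fun i hi => ?_
        rcases Finset.mem_insert.1 hi with rfl | hi
        · rw [hT, map_add, map_smul, hjx₀]; simp
        · exact hx i hi)
      have hsum : 0 ≤ ∑ i ∈ s, μ i * a i x₀ :=
        Finset.sum_nonneg fun i hi => mul_nonneg (hμ i) (hx₀ i hi)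
      refine ⟨Function.update μ j (-c x₀ + ∑ i ∈ s, μ i * a i x₀), fun i => ?_, ?_⟩
      · by_cases hi : i = j
        · subst hi; simp only [Function.update_self]; linarith
        · simp [hi, hμ i]
      · rw [Finset.sum_insert hj, Function.update_self]
        have hs : ∑ i ∈ s, Function.update μ j (-c x₀ + ∑ i ∈ s, μ i * a i x₀) i • a i =
            ∑ i ∈ s, μ i • a i := by
          refine Finset.sum_congr rfl fun i hi => ?_
          rw [Function.update_of_ne (ne_of_mem_of_not_mem hi hj)]
        rw [hs]
        ext x
        have hx := LinearMap.congr_fun hceq x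
        simp only [LinearMap.comp_apply, hT, map_add, map_smul, LinearMap.sum_apply,
          LinearMap.smul_apply, smul_eq_mul, mul_add, Finset.sum_add_distrib] at hx
        simp only [LinearMap.add_apply, LinearMap.sum_apply, LinearMap.smul_apply, smul_eq_mul]
        have h3 : ∑ i ∈ s, μ i * (a j x * a i x₀) = a j x * ∑ i ∈ s, μ i * a i x₀ := by
          rw [Finset.mul_sum]; exact Finset.sum_congr rfl fun i _ => by ring
        rw [h3] at hx
        linarith

/-- Multipliers for the minimization of a linear functional over a polyhedron. -/
theorem exists_multipliers_of_polyhedron {ι V : Type*} [Fintype ι] [AddCommGroup V] [Module ℝ V]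
    (a : ι → V →ₗ[ℝ] ℝ) (b : ι → ℝ) (c : V →ₗ[ℝ] ℝ) (u : V) (hu : ∀ i, b i ≤ a i u)
    (hmin : ∀ x, (∀ i, b i ≤ a i x) → c u ≤ c x) :
    ∃ μ : ι → ℝ, (∀ i, 0 ≤ μ i) ∧ (∀ i, μ i * (a i u - b i) = 0) ∧ c = ∑ i, μ i • a i := by
  classical
  -- Only active constraints enter Farkas' lemma: inactive ones tolerate a short step in any
  -- direction. Their multipliers are set to zero, which gives complementarity.
  let s : Finset ι := Finset.univ.filter fun i => a i u = b i
  obtain ⟨μ, hμ, hc⟩ := farkas_linear s a c (by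
    intro d hd
    have hev : ∀ᶠ t : ℝ in 𝓝[>] 0, ∀ i, b i ≤ a i (u + t • d) := by
      rw [eventually_all]
      intro i
      by_cases hi : a i u = b i
      · filter_upwards [self_mem_nhdsWithin] with t ht
        rw [map_add, map_smul, hi, smul_eq_mul]
        have := mul_nonneg (le_of_lt (mem_Ioi.1 ht)) (hd i (by simp [s, hi]))
        linarith
      · have hlt : b i < a i u := lt_of_le_of_ne (hu i) (Ne.symm hi)
        have hcont : Tendsto (fun t : ℝ => a i u + t * a i d) (𝓝[>] 0) (𝓝 (a i u)) := by
          have : Continuous fun t : ℝ => a i u + t * a i d := by fun_prop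
          have h0 := this.tendsto 0
          simp only [zero_mul, add_zero] at h0
          exact h0.mono_left nhdsWithin_le_nhds
        filter_upwards [hcont.eventually (lt_mem_nhds hlt)] with t ht
        rw [map_add, map_smul, smul_eq_mul]
        exact ht.le
    obtain ⟨t, ht, ht0⟩ := (hev.and self_mem_nhdsWithin).exists
    have h1 := hmin _ ht
    rw [map_add, map_smul, smul_eq_mul] at h1
    exact nonneg_of_mul_nonneg_right (by linarith) (mem_Ioi.1 ht0))
  refine ⟨fun i => if a i u = b i then μ i else 0, fun i => ?_, fun i => ?_, ?_⟩
  · dsimp only; split_ifs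
    · exact hμ i
    · exact le_rfl
  · dsimp only; split_ifs with h
    · rw [h]; ring
    · ring
  · rw [hc, Finset.sum_filter]
    refine Finset.sum_congr rfl fun i _ => ?_
    rw [ite_smul, zero_smul]

/-! ### Inequalities at minimizers -/

/-- Quadratic growth at a minimizer of a convex function plus a squared distance. -/
theorem ConvexOn.add_sq_dist_le_of_isMin {E : Type*} [NormedAddCommGroup E]
    [InnerProductSpace ℝ E] {S : Set E} {F : E → ℝ} (hF : ConvexOn ℝ S F) {ρ : ℝ} {c m y : E}
    (hm : m ∈ S) (hy : y ∈ S)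
    (hmin : ∀ x ∈ S, F m + ρ / 2 * ‖c - m‖ ^ 2 ≤ F x + ρ / 2 * ‖c - x‖ ^ 2) :
    F m + ρ / 2 * ‖c - m‖ ^ 2 + ρ / 2 * ‖y - m‖ ^ 2 ≤ F y + ρ / 2 * ‖c - y‖ ^ 2 := by
  -- Minimality is tested on the segment from `m` to `y`. The squared norm exceeds convexity by
  -- exactly `t (1 - t) ‖y - m‖²`; dividing by `t` and letting `t → 0` gives the growth term.
  have key : ∀ t : ℝ, t ∈ Ioo (0 : ℝ) 1 →
      F m + ρ / 2 * ‖c - m‖ ^ 2 + (1 - t) * (ρ / 2 * ‖y - m‖ ^ 2) ≤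
        F y + ρ / 2 * ‖c - y‖ ^ 2 := by
    intro t ht
    have hx : (1 - t) • m + t • y ∈ S :=
      hF.1 hm hy (by linarith [ht.2]) ht.1.le (by ring)
    have h1 := hmin _ hx
    have h2 := hF.2 hm hy (show 0 ≤ 1 - t by linarith [ht.2]) ht.1.le (by ring)
    simp only [smul_eq_mul] at h2
    have h3 : ‖c - ((1 - t) • m + t • y)‖ ^ 2 =
        (1 - t) * ‖c - m‖ ^ 2 + t * ‖c - y‖ ^ 2 - t * (1 - t) * ‖y - m‖ ^ 2 := by
      have e1 : c - ((1 - t) • m + t • y) = (1 - t) • (c - m) + t • (c - y) := by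
        module
      have e2 : y - m = (c - m) - (c - y) := by abel
      rw [e1, e2, norm_add_sq_real, norm_sub_sq_real (c - m), norm_smul, norm_smul, inner_smul_left,
        inner_smul_right, mul_pow, mul_pow, Real.norm_eq_abs, Real.norm_eq_abs, sq_abs, sq_abs]
      simp only [conj_trivial]
      ring
    rw [h3] at h1
    have h4 : 0 ≤ t * (F y + ρ / 2 * ‖c - y‖ ^ 2 -
        (F m + ρ / 2 * ‖c - m‖ ^ 2 + (1 - t) * (ρ / 2 * ‖y - m‖ ^ 2))) := by
      linear_combination h1 + h2
    have := nonneg_of_mul_nonneg_right h4 ht.1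
    linarith
  have hlim : Tendsto (fun t : ℝ => F m + ρ / 2 * ‖c - m‖ ^ 2 + (1 - t) * (ρ / 2 * ‖y - m‖ ^ 2))
      (𝓝[>] 0) (𝓝 (F m + ρ / 2 * ‖c - m‖ ^ 2 + ρ / 2 * ‖y - m‖ ^ 2)) := by
    have : Continuous fun t : ℝ =>
      F m + ρ / 2 * ‖c - m‖ ^ 2 + (1 - t) * (ρ / 2 * ‖y - m‖ ^ 2) := by fun_prop
    have h0 := this.tendsto 0
    simp only [sub_zero, one_mul] at h0
    exact h0.mono_left nhdsWithin_le_nhds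
  refine le_of_tendsto hlim ?_
  filter_upwards [Ioo_mem_nhdsGT (zero_lt_one' ℝ)] with t ht using key t ht

/-- A right-sided minimum at `0` forces a nonnegative derivative. -/
theorem HasDerivAt.nonneg_of_le_right {ψ : ℝ → ℝ} {a : ℝ} (h : HasDerivAt ψ a 0)
    (hle : ∀ t ∈ Ioo (0 : ℝ) 1, ψ 0 ≤ ψ t) : 0 ≤ a := by
  have hs := h.hasDerivWithinAt (s := Ioi 0)
  rw [hasDerivWithinAt_iff_tendsto_slope' (by simp)] at hs
  refine ge_of_tendsto hs ?_
  filter_upwards [Ioo_mem_nhdsGT (zero_lt_one' ℝ)] with t ht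
  rw [slope_def_field]
  exact div_nonneg (sub_nonneg.2 (hle t ht)) (by linarith [ht.1])

/-! ### Sequences -/

/-- A positive bounded sequence can be multiplied by a factor `> 1` only finitely often. -/
theorem eventually_const_of_bounded_increase {ρ : ℕ → ℝ} {q R : ℝ} {p : ℕ → Prop}
    [DecidablePred p] (hq : 1 < q) (h0 : 0 < ρ 0)
    (hsucc : ∀ k, ρ (k + 1) = if p k then q * ρ k else ρ k) (hR : ∀ k, ρ k ≤ R) :
    (∀ k, ρ 0 ≤ ρ k) ∧ ∃ K, ∀ k ≥ K, ρ k = ρ K ∧ ¬ p k := by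
  have hpos : ∀ k, ρ 0 ≤ ρ k := by
    intro k
    induction k with
    | zero => exact le_rfl
    | succ k ih => rw [hsucc]; split_ifs <;> nlinarith
  have hmono : Monotone ρ := monotone_nat_of_le_succ fun k => by
    rw [hsucc]; split_ifs <;> nlinarith [hpos k]
  have hK : ∃ K, ∀ k ≥ K, ¬ p k := by
    by_contra hcon
    push Not at hcon
    have hgrow : ∀ j : ℕ, ∃ k, q ^ j * ρ 0 ≤ ρ k := by
      intro j
      induction j with
      | zero => exact ⟨0, by simp⟩
      | succ j ih =>
        obtain ⟨k, hk⟩ := ih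
        obtain ⟨l, hl, hpl⟩ := hcon k
        refine ⟨l + 1, ?_⟩
        rw [hsucc, if_pos hpl, pow_succ']
        have := hk.trans (hmono hl)
        nlinarith
    obtain ⟨j, hj⟩ := ((tendsto_pow_atTop_atTop_of_one_lt hq).eventually
      (eventually_gt_atTop (R / ρ 0))).exists
    obtain ⟨k, hk⟩ := hgrow j
    rw [div_lt_iff₀ h0] at hj
    linarith [hR k]
  refine ⟨hpos, ?_⟩
  obtain ⟨K, hK⟩ := hK
  refine ⟨K, fun k hk => ⟨?_, hK k hk⟩⟩
  induction k, hk using Nat.le_induction with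
  | base => rfl
  | succ k hk ih => rw [hsucc, if_neg (hK k hk), ih]

/-- The basic step inequality behind finite length under the Kurdyka-Lojasiewicz property. -/
theorem two_mul_le_of_desingularizing {φ : ℝ → ℝ} {η a c s s' D D' : ℝ}
    (hφ : ConcaveOn ℝ (Ico 0 η) φ) (hφ' : ∀ s ∈ Ioo 0 η, 0 < deriv φ s) (ha : 0 < a) (hc : 0 < c)
    (hD : 0 ≤ D) (hs' : 0 ≤ s') (hs : s < η) (hdec : s' + a * D' ^ 2 ≤ s)
    (hKL : 0 < s → 1 ≤ deriv φ s * (c * D)) :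
    2 * D' ≤ D + c / a * (φ s - φ s') := by
  have haD : 0 ≤ a * D' ^ 2 := by positivity
  rcases (show s' ≤ s by linarith).eq_or_lt with h | h
  · have h1 : D' = 0 := by
      have : a * D' ^ 2 = 0 := by linarith
      simpa [ha.ne'] using this
    rw [h, h1]; simpa using hD
  · have hs0 : 0 < s := hs'.trans_lt h
    have hmem : s ∈ Ioo 0 η := ⟨hs0, hs⟩
    have hder : 0 < deriv φ s := hφ' s hmem
    have hdiff : DifferentiableAt ℝ φ s := differentiableAt_of_deriv_ne_zero hder.ne'
    -- Concavity: the slope at the right endpoint is at most the chord slope, so a decrease of `s`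
    -- forces a proportional decrease of `φ`.
    have hsl := hφ.le_slope_of_hasDerivAt ⟨hs', h.trans hs⟩ ⟨hs0.le, hs⟩ h hdiff.hasDerivAt
    rw [slope_def_field, le_div_iff₀ (by linarith)] at hsl
    have h1 : deriv φ s * (a * D' ^ 2) ≤ φ s - φ s' :=
      (mul_le_mul_of_nonneg_left (by linarith) hder.le).trans hsl
    have h2 := hKL hs0
    have hcD : 0 ≤ c * D := by positivity
    have h3 : a * D' ^ 2 ≤ c * D * (φ s - φ s') := by
      calc a * D' ^ 2 = 1 * (a * D' ^ 2) := by ring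
        _ ≤ deriv φ s * (c * D) * (a * D' ^ 2) := mul_le_mul_of_nonneg_right h2 haD
        _ = c * D * (deriv φ s * (a * D' ^ 2)) := by ring
        _ ≤ _ := mul_le_mul_of_nonneg_left h1 hcD
    have h4 : D' ^ 2 ≤ D * (c / a * (φ s - φ s')) := by
      rw [show D * (c / a * (φ s - φ s')) = c * D * (φ s - φ s') / a by ring, le_div_iff₀ ha]
      linarith
    have h5 : 0 ≤ c / a * (φ s - φ s') := by
      have : 0 ≤ φ s - φ s' := le_trans (by positivity) h1
      positivity
    refine abs_le_of_sq_le_sq' ?_ (by positivity) |>.2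
    -- Arithmetic-geometric mean inequality applied to `h4`.
    nlinarith [sq_nonneg (D - c / a * (φ s - φ s'))]

/-- Finite length of a descent sequence with the Kurdyka-Lojasiewicz inequality near a cluster
point. -/
theorem summable_of_desingularizing {X : Type*} [PseudoMetricSpace X] {z : ℕ → X} {x : X}
    {D l : ℕ → ℝ} {lstar a c B η : ℝ} {U : Set X} {φ : ℝ → ℝ} {σ : ℕ → ℕ}
    (hD : ∀ k, 0 ≤ D k) (hDlim : Tendsto D atTop (𝓝 0)) (ha : 0 < a) (hc : 0 < c) (hB : 0 ≤ B)
    (hl : ∀ k, lstar ≤ l k) (hllim : Tendsto l atTop (𝓝 lstar))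
    (hdec : ∀ k, l (k + 1) + a * D (k + 1) ^ 2 ≤ l k)
    (hz : ∀ k, dist (z k) (z (k + 1)) ≤ B * (D k + D (k + 1)))
    (hσ : StrictMono σ) (hzσ : Tendsto (fun j => z (σ j)) atTop (𝓝 x))
    (hη : 0 < η) (hU : U ∈ 𝓝 x) (hφc : ContinuousOn φ (Ico 0 η))
    (hφ : ConcaveOn ℝ (Ico 0 η) φ) (hφ0 : φ 0 = 0) (hφnn : ∀ s ∈ Ico 0 η, 0 ≤ φ s)
    (hφ' : ∀ s ∈ Ioo 0 η, 0 < deriv φ s)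
    (hKL : ∀ k, z k ∈ U → lstar < l k → l k < lstar + η →
      1 ≤ deriv φ (l k - lstar) * (c * D k)) :
    Summable D := by
  obtain ⟨r, hr, hrU⟩ := Metric.mem_nhds_iff.1 hU
  have hanti : Antitone l := antitone_nat_of_succ_le fun k => by
    have : 0 ≤ a * D (k + 1) ^ 2 := by positivity
    linarith [hdec k]
  have hψ : Tendsto (fun k => φ (l k - lstar)) atTop (𝓝 0) := by
    have h1 : Tendsto (fun k => l k - lstar) atTop (𝓝[Ico 0 η] 0) := by
      refine tendsto_nhdsWithin_iff.2 ⟨by simpa using hllim.sub_const lstar, ?_⟩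
      filter_upwards [hllim.eventually (gt_mem_nhds (show lstar < lstar + η by linarith))]
        with k hk
      exact ⟨sub_nonneg.2 (hl k), by linarith⟩
    have h2 := (hφc 0 ⟨le_rfl, hη⟩).tendsto.comp h1
    rwa [hφ0] at h2
  -- This bounds the total displacement from index `k`: a length sum of at most `D k + c / a * φ`,
  -- counted twice because consecutive `D` overlap, plus one more `D k`.
  have hsmall : Tendsto (fun k => B * (3 * D k + 2 * (c / a * φ (l k - lstar)))) atTop (𝓝 0) := by
    have := ((hDlim.const_mul 3).add ((hψ.const_mul (c / a)).const_mul 2)).const_mul B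
    simpa using this
  have hσt := hσ.tendsto_atTop
  obtain ⟨j₀, ⟨hj1, hj2⟩, hj3⟩ := (((hσt.eventually (hsmall.eventually
    (gt_mem_nhds (half_pos hr)))).and (hσt.eventually (hllim.eventually
    (gt_mem_nhds (show lstar < lstar + η by linarith))))).and
    (hzσ.eventually (Metric.ball_mem_nhds x (half_pos hr)))).exists
  set N := σ j₀ with hN
  have hrange : ∀ j, l (N + j) - lstar < η := fun j => by
    linarith [hanti (Nat.le_add_right N j)]
  have hnn : ∀ j, 0 ≤ c / a * φ (l (N + j) - lstar) := fun j =>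
    mul_nonneg (by positivity) (hφnn _ ⟨sub_nonneg.2 (hl _), hrange j⟩)
  -- The two bounds need a joint induction: the length bound keeps the next point in `U`, and being
  -- in `U` licenses the step inequality that extends the length bound. The `φ` terms telescope.
  have main : ∀ j, ∑ i ∈ Finset.range j, D (N + 1 + i) + D (N + j) +
        c / a * φ (l (N + j) - lstar) ≤ D N + c / a * φ (l N - lstar) ∧
      dist (z N) (z (N + j)) + B * D (N + j) ≤
        B * (D N + 2 * ∑ i ∈ Finset.range j, D (N + 1 + i)) := by
    intro j
    induction j with
    | zero => simp
    | succ j ih =>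
      obtain ⟨ih1, ih2⟩ := ih
      have hmem : z (N + j) ∈ U := by
        apply hrU
        rw [Metric.mem_ball]
        have hS : ∑ i ∈ Finset.range j, D (N + 1 + i) ≤ D N + c / a * φ (l N - lstar) := by
          linarith [hD (N + j), hnn j]
        have h1 : dist (z N) (z (N + j)) ≤ B * (3 * D N + 2 * (c / a * φ (l N - lstar))) := by
          have h2 : B * (D N + 2 * ∑ i ∈ Finset.range j, D (N + 1 + i)) ≤
              B * (3 * D N + 2 * (c / a * φ (l N - lstar))) :=
            mul_le_mul_of_nonneg_left (by linarith) hB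
          linarith [mul_nonneg hB (hD (N + j))]
        have h3 : dist (z N) x < r / 2 := hj3
        have h4 := dist_triangle (z (N + j)) (z N) x
        rw [dist_comm (z (N + j)) (z N)] at h4
        linarith
      have hstep := two_mul_le_of_desingularizing (s := l (N + j) - lstar)
        (s' := l (N + j + 1) - lstar) (D' := D (N + j + 1)) hφ hφ' ha hc (hD (N + j))
        (sub_nonneg.2 (hl _)) (hrange j) (by linarith [hdec (N + j)])
        (fun h => hKL _ hmem (by linarith) (by linarith [hrange j]))
      rw [Finset.sum_range_succ, show N + 1 + j = N + j + 1 by ring,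
        show N + (j + 1) = N + j + 1 by ring]
      constructor
      · linarith
      · have h1 := dist_triangle (z N) (z (N + j)) (z (N + j + 1))
        have h2 := hz (N + j)
        linarith
  have hsum : Summable fun i => D (N + 1 + i) := by
    refine summable_of_sum_range_le (c := D N + c / a * φ (l N - lstar)) (fun i => hD _) fun j => ?_
    linarith [(main j).1, hD (N + j), hnn j]
  have hsum' : Summable fun i => D (i + (N + 1)) := by simpa only [add_comm] using hsum
  exact (summable_nat_add_iff (N + 1)).1 hsum'

/-! ### Stacked triples -/

theorem Triple.norm_le {E : Type} [NormedAddCommGroup E] (z : Triple E) :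
    ‖z‖ ≤ ‖z 0‖ + ‖z 1‖ + ‖z 2‖ := by
  have h := PiLp.norm_sq_eq_of_L2 (fun _ : Fin 3 => E) z
  rw [Fin.sum_univ_three] at h
  refine abs_le_of_sq_le_sq' ?_ (by positivity) |>.2
  have h1 := mul_nonneg (norm_nonneg (z 0)) (norm_nonneg (z 1))
  have h2 := mul_nonneg (norm_nonneg (z 0)) (norm_nonneg (z 2))
  have h3 := mul_nonneg (norm_nonneg (z 1)) (norm_nonneg (z 2))
  nlinarith

theorem Triple.inner_eq {E : Type} [NormedAddCommGroup E] [InnerProductSpace ℝ E]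
    (u v : Triple E) :
    inner ℝ u v = inner ℝ (u 0) (v 0) + inner ℝ (u 1) (v 1) + inner ℝ (u 2) (v 2) := by
  rw [PiLp.inner_apply, Fin.sum_univ_three]

theorem Triple.norm_apply_le {E : Type} [NormedAddCommGroup E] (z : Triple E) (i : Fin 3) :
    ‖z i‖ ≤ ‖z‖ := PiLp.norm_apply_le z i

theorem Triple.tendsto_iff {E α : Type} [NormedAddCommGroup E] {f : Filter α} {a b c : α → E}
    {z : Triple E} : Tendsto (fun j => (!₂[a j, b j, c j] : Triple E)) f (𝓝 z) ↔
      Tendsto a f (𝓝 (z 0)) ∧ Tendsto b f (𝓝 (z 1)) ∧ Tendsto c f (𝓝 (z 2)) := by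
  constructor
  · intro h
    have h' : ∀ i : Fin 3, Tendsto (fun j => (!₂[a j, b j, c j] : Triple E) i) f (𝓝 (z i)) :=
      fun i => ((PiLp.continuous_apply 2 (fun _ : Fin 3 => E) i).tendsto z).comp h
    exact ⟨h' 0, h' 1, h' 2⟩
  · rintro ⟨h0, h1, h2⟩
    rw [tendsto_iff_norm_sub_tendsto_zero] at h0 h1 h2 ⊢
    refine squeeze_zero (fun _ => norm_nonneg _) (fun j => Triple.norm_le _) ?_
    simpa using (h0.add h1).add h2

/-- A sequence of real enorms with finite lower limit has a bounded subsequence. -/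
theorem exists_frequently_norm_le_of_liminf_lt_top {E : Type*} [NormedAddCommGroup E] {u : ℕ → E}
    (h : liminf (fun k => ‖u k‖ₑ) atTop < ⊤) : ∃ R : ℝ, ∃ᶠ k in atTop, ‖u k‖ ≤ R := by
  obtain ⟨c, hc, hctop⟩ := exists_between h
  lift c to NNReal using hctop.ne
  refine ⟨c, (frequently_lt_of_liminf_lt (by isBoundedDefault) hc).mono fun k hk => ?_⟩
  have : ‖u k‖₊ < c := by simpa [enorm] using hk
  exact_mod_cast this.le

/-! ### Inequalities in inner product spaces used for the augmented Lagrangian -/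

section

variable {E : Type*} [NormedAddCommGroup E] [InnerProductSpace ℝ E]

/-- Combines the two minimality inequalities of one sweep into a subgradient inequality. -/
theorem augLag_subgradient_aux {ρ hw hw' py py' : ℝ} {w w' y y' y₀ l l' l₀ : E}
    (hl : l' = l₀ + ρ • (w' - y'))
    (h1 : hw' + inner ℝ l₀ (w' - y₀) + ρ / 2 * ‖w' - y₀‖ ^ 2 ≤
      hw + inner ℝ l₀ (w - y₀) + ρ / 2 * ‖w - y₀‖ ^ 2)
    (h2 : py' + inner ℝ l₀ (w' - y') + ρ / 2 * ‖w' - y'‖ ^ 2 ≤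
      py + inner ℝ l₀ (w' - y) + ρ / 2 * ‖w' - y‖ ^ 2) :
    hw' + py' + inner ℝ l' (w' - y') + ρ / 2 * ‖w' - y'‖ ^ 2 +
      (inner ℝ (l' - l₀ - ρ • (y' - y₀)) (w - w') + inner ℝ (l₀ - l') (y - y') +
        inner ℝ (w' - y') (l - l')) +
      (inner ℝ (l - l') ((w - w') - (y - y')) - ρ * inner ℝ (w - w') (y - y')) ≤
    hw + py + inner ℝ l (w - y) + ρ / 2 * ‖w - y‖ ^ 2 := by
  -- The squares of `w` and `y` match on both sides, so after expansion only terms linear or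
  -- bilinear in the displacements remain. The symmetry rewrites merely identify equal inner
  -- products.
  subst hl
  simp only [norm_sub_sq_real, inner_sub_left, inner_sub_right, inner_add_left, inner_add_right,
    inner_smul_left, inner_smul_right, conj_trivial, real_inner_self_eq_norm_sq] at h1 h2 ⊢
  simp only [real_inner_comm w w', real_inner_comm y w, real_inner_comm y' w, real_inner_comm y w',
    real_inner_comm y' w', real_inner_comm y₀ w, real_inner_comm y₀ w', real_inner_comm y y',
    real_inner_comm w l₀, real_inner_comm w' l₀,
    real_inner_comm y l₀, real_inner_comm y' l₀, real_inner_comm y₀ l₀, real_inner_comm w l,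
    real_inner_comm w' l, real_inner_comm y l, real_inner_comm y' l] at h1 h2 ⊢
  linarith

end

/-! ### Continuity, closedness and convexity of the problem data -/

namespace ProblemData

variable {n m : ℕ} (P : ProblemData n m)

theorem contDiff_fQ : ContDiff ℝ 1 P.fQ := by
  unfold fQ
  simp only [dotProduct, Matrix.mulVec]
  fun_prop

theorem continuous_h : Continuous P.h := by
  have := P.contDiff_fQ.continuous
  unfold h
  fun_prop

theorem continuous_p (hg : Continuous P.g) : Continuous P.p := by
  unfold p
  fun_prop

theorem tendsto_augLag (hg : Continuous P.g) (ρ : ℝ) {α : Type} {f : Filter α}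
    {a b c : α → Pt n} {a' b' c' : Pt n} (ha : Tendsto a f (𝓝 a')) (hb : Tendsto b f (𝓝 b'))
    (hc : Tendsto c f (𝓝 c')) :
    Tendsto (fun k => P.augLag (a k) (b k) (c k) ρ) f (𝓝 (P.augLag a' b' c' ρ)) := by
  have h1 := (P.continuous_h.tendsto a').comp ha
  have h2 := ((P.continuous_p hg).tendsto b').comp hb
  unfold augLag
  exact ((h1.add h2).add (hc.inner (ha.sub hb))).add (((ha.sub hb).norm.pow 2).const_mul _)

theorem isClosed_Z₁ : IsClosed P.Z₁ := by
  unfold Z₁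
  exact isClosed_eq (by fun_prop) continuous_const

theorem isClosed_Z₂ : IsClosed P.Z₂ := by
  have h : ∀ j, Continuous fun w : Pt n => (P.A *ᵥ (w 0 - w 1).ofLp) j := fun j => by
    simp only [Matrix.mulVec, dotProduct]
    fun_prop
  unfold Z₂
  simp only [ofPred_and, ofPred_forall]
  refine .inter ?_ (.inter ?_ (.inter ?_ ?_))
  · exact isClosed_iInter fun i => .inter (isClosed_le (by fun_prop) (by fun_prop))
      (isClosed_le (by fun_prop) (by fun_prop))
  · exact isClosed_iInter fun i => isClosed_le (by fun_prop) (by fun_prop)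
  · exact isClosed_iInter fun i => isClosed_le (by fun_prop) (by fun_prop)
  · exact isClosed_iInter fun i => isClosed_le (by fun_prop) (h i)

theorem convex_Z₂ : Convex ℝ P.Z₂ := by
  intro u hu v hv a b ha hb hab
  obtain ⟨hu2, hu0, hu1, huA⟩ := hu
  obtain ⟨hv2, hv0, hv1, hvA⟩ := hv
  refine ⟨fun i => ⟨?_, ?_⟩, fun i => ?_, fun i => ?_, fun j => ?_⟩
  · have := mul_nonneg ha (hu2 i).1
    have := mul_nonneg hb (hv2 i).1
    simp only [PiLp.add_apply, PiLp.smul_apply, smul_eq_mul]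
    linarith
  · have := mul_le_mul_of_nonneg_left (hu2 i).2 ha
    have := mul_le_mul_of_nonneg_left (hv2 i).2 hb
    simp only [PiLp.add_apply, PiLp.smul_apply, smul_eq_mul]
    linarith
  · have := mul_nonneg ha (hu0 i)
    have := mul_nonneg hb (hv0 i)
    simp only [PiLp.add_apply, PiLp.smul_apply, smul_eq_mul]
    linarith
  · have := mul_nonneg ha (hu1 i)
    have := mul_nonneg hb (hv1 i)
    simp only [PiLp.add_apply, PiLp.smul_apply, smul_eq_mul]
    linarith
  · have h1 := mul_le_mul_of_nonneg_left (huA j) ha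
    have h2 := mul_le_mul_of_nonneg_left (hvA j) hb
    have h3 : ((a • u + b • v) 0 - (a • u + b • v) 1).ofLp =
        a • (u 0 - u 1).ofLp + b • (v 0 - v 1).ofLp := by
      ext i
      simp
      ring
    rw [h3, Matrix.mulVec_add, Matrix.mulVec_smul, Matrix.mulVec_smul]
    simp only [Pi.add_apply, Pi.smul_apply, smul_eq_mul]
    have : P.b j = a * P.b j + b * P.b j := by rw [← add_mul, hab, one_mul]
    linarith

theorem convexOn_p (hg : ConvexOn ℝ univ P.g) : ConvexOn ℝ univ P.p := by
  refine ⟨convex_univ, fun u _ v _ a b ha hb hab => ?_⟩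
  have := hg.2 (mem_univ (u 0 - u 1)) (mem_univ (v 0 - v 1)) ha hb hab
  have h3 : (a • u + b • v) 0 - (a • u + b • v) 1 = a • (u 0 - u 1) + b • (v 0 - v 1) := by
    simp only [PiLp.add_apply, PiLp.smul_apply]
    module
  rwa [p, h3]

theorem H_of_mem {ρ : ℝ} {z : Triple (Pt n)} (h0 : z 0 ∈ P.Z₁) (h1 : z 1 ∈ P.Z₂) :
    P.H ρ z = (P.augLag (z 0) (z 1) (z 2) ρ : EReal) := by
  simp [H, indicatorFn, h0, h1]

theorem H_of_notMem {ρ : ℝ} {z : Triple (Pt n)} (h : ¬ (z 0 ∈ P.Z₁ ∧ z 1 ∈ P.Z₂)) :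
    P.H ρ z = ⊤ := by
  unfold H indicatorFn
  by_cases h0 : z 0 ∈ P.Z₁ <;> by_cases h1 : z 1 ∈ P.Z₂ <;>
    simp_all

end ProblemData

/-! ### Descent and explicit subgradients along one sweep -/

theorem frechetSubdiff_subset_limitingSubdiff {E : Type} [NormedAddCommGroup E]
    [InnerProductSpace ℝ E] (F : E → EReal) (x : E) :
    frechetSubdiff F x ⊆ limitingSubdiff F x := fun v hv =>
  ⟨hv.1, hv.2.1, fun _ => x, fun _ => v, tendsto_const_nhds, tendsto_const_nhds, fun _ => hv,
    tendsto_const_nhds⟩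

/-- A quadratic lower bound with linear part `v` makes `v` a Fréchet subgradient. -/
theorem mem_frechetSubdiff_of_quadratic_bound {E : Type} [NormedAddCommGroup E]
    [InnerProductSpace ℝ E] {F : E → EReal} {x v : E} {r c : ℝ} (hx : F x = r)
    (h : ∀ y, ((r + inner ℝ v (y - x) - c * ‖y - x‖ ^ 2 : ℝ) : EReal) ≤ F y) :
    v ∈ frechetSubdiff F x := by
  refine ⟨by simp [hx], by simp [hx], fun ε hε => ?_⟩
  have hlim : Tendsto (fun y => c * ‖y - x‖) (𝓝 x) (𝓝 0) := by
    have : Continuous fun y => c * ‖y - x‖ := by fun_prop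
    simpa using this.tendsto x
  filter_upwards [hlim.eventually (gt_mem_nhds hε)] with y hy
  refine le_trans ?_ (h y)
  rw [hx, EReal.toReal_coe, EReal.coe_le_coe_iff]
  have := mul_le_mul_of_nonneg_right hy.le (norm_nonneg (y - x))
  rw [mul_assoc, ← sq] at this
  linarith

namespace IsADMMSequence

variable {n m : ℕ} {P : ProblemData n m} {δ δρ ρmax : ℝ} {w y lam : ℕ → Pt n} {ρs : ℕ → ℝ}

/-- The multiplier update read backwards; every bound on the multiplier step becomes a bound on the
primal gap. -/
theorem w_sub_y (h : IsADMMSequence P δ δρ ρmax w y lam ρs) {k : ℕ} (hρ : 0 < ρs k) :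
    w (k + 1) - y (k + 1) = (ρs k)⁻¹ • (lam (k + 1) - lam k) := by
  rw [h.lam_succ, add_sub_cancel_left, smul_smul, inv_mul_cancel₀ hρ.ne', one_smul]

/-- One sweep changes the augmented Lagrangian by at most
`‖Δλ‖² / ρ - (ρ / 2) ‖Δy‖²`. -/
theorem augLag_succ_le (h : IsADMMSequence P δ δρ ρmax w y lam ρs)
    (hg : ConvexOn ℝ univ P.g) {k : ℕ} (hρ : 0 < ρs k) (hw : w k ∈ P.Z₁) (hy : y k ∈ P.Z₂) :
    P.augLag (w (k + 1)) (y (k + 1)) (lam (k + 1)) (ρs k) ≤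
      P.augLag (w k) (y k) (lam k) (ρs k) + ‖lam (k + 1) - lam k‖ ^ 2 / ρs k -
        ρs k / 2 * ‖y (k + 1) - y k‖ ^ 2 := by
  have h1 := h.w_min k (w k) hw
  have hF : ConvexOn ℝ P.Z₂ fun u => P.h (w (k + 1)) + P.p u + inner ℝ (lam k) (w (k + 1) - u) := by
    have e1 := (P.convexOn_p hg).subset (subset_univ P.Z₂) P.convex_Z₂
    refine ⟨e1.1, fun u hu v hv a b ha hb hab => ?_⟩
    have e2 := e1.2 hu hv ha hb hab
    simp only [smul_eq_mul] at e2 ⊢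
    have e3 : inner ℝ (lam k) (w (k + 1) - (a • u + b • v)) =
        a * inner ℝ (lam k) (w (k + 1) - u) + b * inner ℝ (lam k) (w (k + 1) - v) := by
      rw [← inner_smul_right, ← inner_smul_right, ← inner_add_right]
      congr 1
      rw [show a • (w (k + 1) - u) + b • (w (k + 1) - v) =
        (a + b) • w (k + 1) - (a • u + b • v) by module, hab, one_smul]
    have e4 : P.h (w (k + 1)) = a * P.h (w (k + 1)) + b * P.h (w (k + 1)) := by
      rw [← add_mul, hab, one_mul]
    rw [e3]
    linarith
  have h2 := hF.add_sq_dist_le_of_isMin (ρ := ρs k) (c := w (k + 1)) (h.y_mem k) hy (h.y_min k)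
  -- The only increase in the sweep: `⟪Δλ, w - y⟫` with `w - y = Δλ / ρ`.
  have h3 : P.augLag (w (k + 1)) (y (k + 1)) (lam (k + 1)) (ρs k) =
      P.augLag (w (k + 1)) (y (k + 1)) (lam k) (ρs k) + ‖lam (k + 1) - lam k‖ ^ 2 / ρs k := by
    have e1 : inner ℝ (lam (k + 1)) (w (k + 1) - y (k + 1)) =
        inner ℝ (lam k) (w (k + 1) - y (k + 1)) + ‖lam (k + 1) - lam k‖ ^ 2 / ρs k := by
      rw [← sub_eq_iff_eq_add', ← inner_sub_left, h.w_sub_y hρ, inner_smul_right,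
        real_inner_self_eq_norm_sq]
      ring
    simp only [ProblemData.augLag]
    rw [e1]
    ring
  have h4 : ‖y k - y (k + 1)‖ = ‖y (k + 1) - y k‖ := norm_sub_rev _ _
  rw [h4] at h2
  rw [h3]
  simp only [ProblemData.augLag] at h1 h2 ⊢
  linarith

/-- An explicit Fréchet subgradient of the extended-valued Lagrangian at each iterate. -/
theorem mem_frechetSubdiff (h : IsADMMSequence P δ δρ ρmax w y lam ρs) {k : ℕ} (hρ : 0 < ρs k) :
    (!₂[lam (k + 1) - lam k - ρs k • (y (k + 1) - y k), lam k - lam (k + 1),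
        w (k + 1) - y (k + 1)] : Triple (Pt n)) ∈
      frechetSubdiff (P.H (ρs k)) !₂[w (k + 1), y (k + 1), lam (k + 1)] := by
  -- The constant covers the bilinear remainder: `2 ‖d‖²` from the multiplier term and `ρ ‖d‖²` from
  -- the cross term of the `w` and `y` displacements.
  refine mem_frechetSubdiff_of_quadratic_bound (c := 2 + ρs k)
    (P.H_of_mem (h.w_mem k) (h.y_mem k)) fun z => ?_
  by_cases hz : z 0 ∈ P.Z₁ ∧ z 1 ∈ P.Z₂
  · rw [P.H_of_mem hz.1 hz.2, EReal.coe_le_coe_iff]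
    have h1 := h.w_min k _ hz.1
    have h2 := h.y_min k _ hz.2
    simp only [ProblemData.augLag] at h1 h2
    have h3 := augLag_subgradient_aux (l := z 2) (h.lam_succ k)
      (hw := P.h (z 0)) (hw' := P.h (w (k + 1))) (py := P.p (z 1)) (py' := P.p (y (k + 1)))
      (w := z 0) (y := z 1) (y₀ := y k) (by linarith) (by linarith)
    rw [Triple.inner_eq]
    set d : Triple (Pt n) := z - !₂[w (k + 1), y (k + 1), lam (k + 1)] with hd
    have d0 : z 0 - w (k + 1) = d 0 := rfl
    have d1 : z 1 - y (k + 1) = d 1 := rfl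
    have d2 : z 2 - lam (k + 1) = d 2 := rfl
    rw [d0, d1, d2] at h3
    have n0 := Triple.norm_apply_le d 0
    have n1 := Triple.norm_apply_le d 1
    have n2 := Triple.norm_apply_le d 2
    have e1 : |inner ℝ (d 2) (d 0 - d 1)| ≤ 2 * ‖d‖ ^ 2 := by
      refine (abs_real_inner_le_norm _ _).trans ?_
      have : ‖d 0 - d 1‖ ≤ 2 * ‖d‖ := (norm_sub_le _ _).trans (by linarith)
      calc ‖d 2‖ * ‖d 0 - d 1‖ ≤ ‖d‖ * (2 * ‖d‖) := by gcongr
        _ = 2 * ‖d‖ ^ 2 := by ring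
    have e2 : |inner ℝ (d 0) (d 1)| ≤ ‖d‖ ^ 2 := by
      refine (abs_real_inner_le_norm _ _).trans ?_
      calc ‖d 0‖ * ‖d 1‖ ≤ ‖d‖ * ‖d‖ := by gcongr
        _ = ‖d‖ ^ 2 := by ring
    have e3 := mul_le_mul_of_nonneg_left (abs_le.1 e2).2 hρ.le
    have e4 := (abs_le.1 e1).1
    have c0 : (!₂[w (k + 1), y (k + 1), lam (k + 1)] : Triple (Pt n)) 0 = w (k + 1) := rfl
    have c1 : (!₂[w (k + 1), y (k + 1), lam (k + 1)] : Triple (Pt n)) 1 = y (k + 1) := rfl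
    have c2 : (!₂[w (k + 1), y (k + 1), lam (k + 1)] : Triple (Pt n)) 2 = lam (k + 1) := rfl
    have v0 : (!₂[lam (k + 1) - lam k - ρs k • (y (k + 1) - y k), lam k - lam (k + 1),
        w (k + 1) - y (k + 1)] : Triple (Pt n)) 0 =
        lam (k + 1) - lam k - ρs k • (y (k + 1) - y k) := rfl
    have v1 : (!₂[lam (k + 1) - lam k - ρs k • (y (k + 1) - y k), lam k - lam (k + 1),
        w (k + 1) - y (k + 1)] : Triple (Pt n)) 1 = lam k - lam (k + 1) := rfl
    have v2 : (!₂[lam (k + 1) - lam k - ρs k • (y (k + 1) - y k), lam k - lam (k + 1),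
        w (k + 1) - y (k + 1)] : Triple (Pt n)) 2 = w (k + 1) - y (k + 1) := rfl
    rw [c0, c1, c2, v0, v1, v2]
    simp only [ProblemData.augLag]
    linarith
  · rw [P.H_of_notMem hz]
    exact le_top

/-- The distance of `0` to the limiting subdifferential is controlled by the last `y`-step. -/
theorem infEDist_limitingSubdiff_le (h : IsADMMSequence P δ δρ ρmax w y lam ρs) {k : ℕ}
    (hρ : 0 < ρs k) {C : ℝ} (hC : ‖lam (k + 1) - lam k‖ ≤ C * ‖y (k + 1) - y k‖) :
    Metric.infEDist 0 (limitingSubdiff (P.H (ρs k)) !₂[w (k + 1), y (k + 1), lam (k + 1)]) ≤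
      ENNReal.ofReal ((2 * C + ρs k + C / ρs k) * ‖y (k + 1) - y k‖) := by
  refine (Metric.infEDist_le_edist_of_mem
    (frechetSubdiff_subset_limitingSubdiff _ _ (h.mem_frechetSubdiff hρ))).trans ?_
  rw [edist_dist, dist_zero_left]
  refine ENNReal.ofReal_le_ofReal ((Triple.norm_le _).trans ?_)
  have e1 : ‖lam (k + 1) - lam k - ρs k • (y (k + 1) - y k)‖ ≤
      C * ‖y (k + 1) - y k‖ + ρs k * ‖y (k + 1) - y k‖ := by
    refine (norm_sub_le _ _).trans ?_
    rw [norm_smul, Real.norm_of_nonneg hρ.le]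
    linarith
  have e2 : ‖lam k - lam (k + 1)‖ ≤ C * ‖y (k + 1) - y k‖ := by rwa [norm_sub_rev]
  have e3 : ‖w (k + 1) - y (k + 1)‖ ≤ C / ρs k * ‖y (k + 1) - y k‖ := by
    rw [h.w_sub_y hρ, norm_smul, norm_inv, Real.norm_of_nonneg hρ.le, inv_mul_eq_div,
      div_mul_eq_mul_div]
    gcongr
  have := add_le_add (add_le_add e1 e2) e3
  refine le_trans this (le_of_eq (by ring))

end IsADMMSequence

/-! ### First-order conditions -/

section

variable {E : Type*} [NormedAddCommGroup E] [InnerProductSpace ℝ E]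

/-- The residual of projecting `v` onto `s` is orthogonal to `s`, hence by hypothesis to `v`, hence
to itself. If `s = 0`, division by zero gives `κ = 0` and the argument still works. -/
theorem exists_eq_smul_of_forall_inner_eq_zero {s v : E}
    (h : ∀ c : E, inner ℝ s c = 0 → inner ℝ v c = 0) : ∃ κ : ℝ, v = κ • s := by
  refine ⟨inner ℝ s v / ‖s‖ ^ 2, ?_⟩
  set κ := inner ℝ s v / ‖s‖ ^ 2 with hκ
  have h1 : inner ℝ s (v - κ • s) = 0 := by
    rw [inner_sub_right, inner_smul_right, real_inner_self_eq_norm_sq]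
    by_cases hs : s = 0
    · simp [hs]
    · have : ‖s‖ ≠ 0 := norm_ne_zero_iff.2 hs
      rw [hκ]; field_simp; ring
  have h2 : inner ℝ (v - κ • s) (v - κ • s) = 0 := by
    rw [inner_sub_left, inner_smul_left, h1, h _ h1]; simp
  exact sub_eq_zero.1 (inner_self_eq_zero.1 h2)

/-- The multiplier of the constraint `⟪s, ξ⟫ = 0`, `s = x⁺ + x⁻`: a linear form vanishing on all
lines through the point that stay in the constraint set is a multiple of the constraint
gradient `(ξ, ξ, s)`. -/
theorem exists_multiplier_of_lines {s ξ v₀ v₁ v₂ : E} (hs : inner ℝ s ξ = 0)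
    (h : ∀ a b c : E, (∀ t : ℝ, inner ℝ (s + t • (a + b)) (ξ + t • c) = 0) →
      inner ℝ v₀ a + inner ℝ v₁ b + inner ℝ v₂ c = 0) :
    ∃ κ : ℝ, v₀ = κ • ξ ∧ v₁ = κ • ξ ∧ v₂ = κ • s := by
  have h01 : v₀ = v₁ := by
    refine ext_inner_right ℝ fun a => ?_
    have := h a (-a) 0 (by simp [hs])
    simp only [inner_neg_right, inner_zero_right] at this
    linarith
  obtain ⟨κ, hκ⟩ : ∃ κ : ℝ, v₀ = κ • ξ := by
    refine exists_eq_smul_of_forall_inner_eq_zero fun c hc => ?_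
    have := h c 0 0 fun t => by
      rw [add_zero, smul_zero, add_zero, inner_add_left, inner_smul_left, hs, real_inner_comm, hc]
      simp
    simpa using this
  obtain ⟨κ', hκ'⟩ : ∃ κ : ℝ, v₂ = κ • s := by
    refine exists_eq_smul_of_forall_inner_eq_zero fun c hc => ?_
    have := h 0 0 c fun t => by
      rw [add_zero, smul_zero, add_zero, inner_add_right, inner_smul_right, hs, hc]
      simp
    simpa using this
  -- The blocks so far have separate factors. If `ξ` or `s` vanishes, one factor is arbitrary and
  -- can be set equal to the other.
  by_cases hξ0 : ξ = 0
  · refine ⟨κ', ?_, ?_, hκ'⟩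
    · rw [hκ, hξ0, smul_zero, smul_zero]
    · rw [← h01, hκ, hξ0, smul_zero, smul_zero]
  by_cases hs0 : s = 0
  · refine ⟨κ, hκ, h01 ▸ hκ, ?_⟩
    rw [hκ', hs0, smul_zero, smul_zero]
  have hκκ : κ = κ' := by
    -- Along this direction the first-order changes of `⟪s, ξ⟫` cancel and the second-order term is
    -- a multiple of `⟪ξ, s⟫ = 0`, so the whole line is admissible and compares the factors.
    have h1 := h (‖s‖ ^ 2 • ξ) 0 (-(‖ξ‖ ^ 2) • s) fun t => by
      have hs' : inner ℝ ξ s = 0 := by rw [real_inner_comm, hs]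
      simp only [add_zero, inner_add_left, inner_add_right, inner_smul_left, inner_smul_right,
        conj_trivial, hs, hs', real_inner_self_eq_norm_sq]
      ring
    rw [hκ, hκ'] at h1
    simp only [inner_smul_left, inner_smul_right, inner_zero_right, conj_trivial,
      real_inner_self_eq_norm_sq] at h1
    have hξn : ‖ξ‖ ^ 2 ≠ 0 := by simpa using hξ0
    have hsn : ‖s‖ ^ 2 ≠ 0 := by simpa using hs0
    have h2 : (κ - κ') * (‖s‖ ^ 2 * ‖ξ‖ ^ 2) = 0 := by linear_combination h1
    rcases mul_eq_zero.1 h2 with h3 | h3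
    · linarith
    · exact absurd h3 (mul_ne_zero hsn hξn)
  exact ⟨κ, hκ, h01 ▸ hκ, hκκ ▸ hκ'⟩

theorem hasDerivAt_line_of_differentiableAt [CompleteSpace E] {F : E → ℝ} {x : E}
    (hF : DifferentiableAt ℝ F x) (e : E) :
    HasDerivAt (fun t : ℝ => F (x + t • e)) (inner ℝ (gradient F x) e) 0 := by
  have h1 : HasDerivAt (fun t : ℝ => x + t • e) e 0 := by
    simpa using ((hasDerivAt_id (0 : ℝ)).smul_const e).const_add x
  have h2 : HasFDerivAt F (InnerProductSpace.toDual ℝ E (gradient F x)) (x + (0 : ℝ) • e) := by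
    simpa using hF.hasGradientAt.hasFDerivAt
  exact h2.comp_hasDerivAt (0 : ℝ) h1

end

namespace ProblemData

variable {n m : ℕ} (P : ProblemData n m)

theorem add_smul_sub_apply (u d : Pt n) (t : ℝ) :
    (u + t • d) 0 - (u + t • d) 1 = (u 0 - u 1) + t • (d 0 - d 1) := by
  simp only [PiLp.add_apply, PiLp.smul_apply]
  module

/-- Stationarity of `h w + ⟪λ, w⟫` along lines contained in `Z₁`. -/
theorem stationary_of_isMin_Z₁ {u lam : Pt n} {ρ : ℝ}
    (hmin : ∀ w' ∈ P.Z₁, P.augLag u u lam ρ ≤ P.augLag w' u lam ρ) {d : Pt n}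
    (hd : ∀ t : ℝ, u + t • d ∈ P.Z₁) :
    inner ℝ (gradient P.fQ (u 0 - u 1)) (d 0 - d 1) - P.γ * ∑ i, d 2 i + inner ℝ lam d = 0 := by
  have h1 := hasDerivAt_line_of_differentiableAt
    ((P.contDiff_fQ.differentiable one_ne_zero) (u 0 - u 1)) (d 0 - d 1)
  -- Both blocks sit at `u`, so the penalty is purely quadratic in `t` and contributes nothing at
  -- first order.
  have h2 : HasDerivAt (fun t : ℝ => P.γ * ∑ i, (1 - u 2 i) - t * (P.γ * ∑ i, d 2 i) + P.p u +
      t * inner ℝ lam d + ρ / 2 * (t ^ 2 * ‖d‖ ^ 2))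
      (-(P.γ * ∑ i, d 2 i) + inner ℝ lam d) 0 := by
    have e1 := (hasDerivAt_id (0 : ℝ)).mul_const (P.γ * ∑ i, d 2 i)
    have e2 := (hasDerivAt_id (0 : ℝ)).mul_const (inner ℝ lam d)
    have e3 := ((hasDerivAt_pow 2 (0 : ℝ)).mul_const (‖d‖ ^ 2)).const_mul (ρ / 2)
    exact ((((e1.const_sub (P.γ * ∑ i, (1 - u 2 i))).add_const (P.p u)).add e2).add e3).congr_deriv
      (by simp)
  have h3 : (fun t : ℝ => P.augLag (u + t • d) u lam ρ) = fun t : ℝ =>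
      P.fQ ((u 0 - u 1) + t • (d 0 - d 1)) + (P.γ * ∑ i, (1 - u 2 i) - t * (P.γ * ∑ i, d 2 i) +
        P.p u + t * inner ℝ lam d + ρ / 2 * (t ^ 2 * ‖d‖ ^ 2)) := by
    funext t
    have e1 : ∑ i, (1 - (u + t • d) 2 i) = ∑ i, (1 - u 2 i) - t * ∑ i, d 2 i := by
      rw [Finset.mul_sum, ← Finset.sum_sub_distrib]
      refine Finset.sum_congr rfl fun i _ => ?_
      simp only [PiLp.add_apply, PiLp.smul_apply, smul_eq_mul]
      ring
    rw [augLag, h, add_smul_sub_apply, e1, add_sub_cancel_left, inner_smul_right, norm_smul,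
      mul_pow, Real.norm_eq_abs, sq_abs]
    ring
  have h4 := h1.add h2
  have h5 : IsLocalMin (fun t : ℝ => P.augLag (u + t • d) u lam ρ) 0 :=
    Filter.Eventually.of_forall fun t => by simpa using hmin _ (hd t)
  rw [h3] at h5
  have := h5.hasDerivAt_eq_zero h4
  linarith

/-- Variational inequality for `p y - ⟪λ, y⟫` on `Z₂`. -/
theorem variational_ineq_of_isMin_Z₂ (hg : Differentiable ℝ P.g) {u lam : Pt n} {ρ : ℝ}
    (hu : u ∈ P.Z₂) (hmin : ∀ y' ∈ P.Z₂, P.augLag u u lam ρ ≤ P.augLag u y' lam ρ) {y : Pt n}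
    (hy : y ∈ P.Z₂) :
    0 ≤ inner ℝ (gradient P.g (u 0 - u 1)) ((y - u) 0 - (y - u) 1) - inner ℝ lam (y - u) := by
  set d := y - u with hd
  have h1 := hasDerivAt_line_of_differentiableAt (hg (u 0 - u 1)) (d 0 - d 1)
  have h2 : HasDerivAt (fun t : ℝ => P.h u - t * inner ℝ lam d + ρ / 2 * (t ^ 2 * ‖d‖ ^ 2))
      (-inner ℝ lam d) 0 := by
    have e2 := (hasDerivAt_id (0 : ℝ)).mul_const (inner ℝ lam d)
    have e3 := ((hasDerivAt_pow 2 (0 : ℝ)).mul_const (‖d‖ ^ 2)).const_mul (ρ / 2)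
    exact ((e2.const_sub (P.h u)).add e3).congr_deriv (by simp)
  have h3 : ∀ t : ℝ, P.augLag u (u + t • d) lam ρ =
      P.g ((u 0 - u 1) + t • (d 0 - d 1)) +
        (P.h u - t * inner ℝ lam d + ρ / 2 * (t ^ 2 * ‖d‖ ^ 2)) := by
    intro t
    have e1 : u - (u + t • d) = -(t • d) := by abel
    rw [augLag, p, add_smul_sub_apply, e1, inner_neg_right, norm_neg, inner_smul_right, norm_smul,
      mul_pow, Real.norm_eq_abs, sq_abs]
    ring
  have h4 := (h1.add h2).nonneg_of_le_right fun t ht => by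
    have hmem : u + t • d ∈ P.Z₂ := P.convex_Z₂.add_smul_sub_mem hu hy ⟨ht.1.le, ht.2.le⟩
    have e0 := h3 0
    rw [zero_smul, add_zero] at e0
    have := hmin _ hmem
    rw [e0, h3 t] at this
    simpa only [Pi.add_apply] using this
  linarith

/-- The coordinate functional `w ↦ w k i`. -/
def coordForm (k : Fin 3) (i : Fin n) : Pt n →ₗ[ℝ] ℝ where
  toFun w := w k i
  map_add' _ _ := rfl
  map_smul' _ _ := rfl

/-- The constraint functional `w ↦ (A (x⁺ - x⁻)) j`. -/
def rowForm (j : Fin m) : Pt n →ₗ[ℝ] ℝ where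
  toFun w := (P.A *ᵥ (w 0 - w 1).ofLp) j
  map_add' u v := by
    rw [show (u + v) 0 - (u + v) 1 = (u 0 - u 1) + (v 0 - v 1) by
      simp only [PiLp.add_apply]; abel, WithLp.ofLp_add, Matrix.mulVec_add, Pi.add_apply]
  map_smul' t u := by
    rw [show (t • u) 0 - (t • u) 1 = t • (u 0 - u 1) by
      simp only [PiLp.smul_apply, smul_sub], WithLp.ofLp_smul, Matrix.mulVec_smul]
    rfl

theorem gradient_f (hg : Differentiable ℝ P.g) (x : Vec n) :
    gradient P.f x = gradient P.fQ x + gradient P.g x := by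
  have hQ : DifferentiableAt ℝ P.fQ x := (P.contDiff_fQ.differentiable one_ne_zero) x
  have h := (hQ.hasGradientAt.hasFDerivAt.add (hg x).hasGradientAt.hasFDerivAt)
  rw [← map_add] at h
  exact (hasGradientAt_iff_hasFDerivAt.2 h).gradient

/-- A point that minimizes the augmented Lagrangian in both blocks is a KKT point. -/
theorem isKKT_of_isMin (hg : Differentiable ℝ P.g) {u lam : Pt n} {ρ : ℝ} (hu1 : u ∈ P.Z₁)
    (hu2 : u ∈ P.Z₂) (hw : ∀ w' ∈ P.Z₁, P.augLag u u lam ρ ≤ P.augLag w' u lam ρ)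
    (hy : ∀ y' ∈ P.Z₂, P.augLag u u lam ρ ≤ P.augLag u y' lam ρ) : P.IsKKT u := by
  classical
  set q := gradient P.fQ (u 0 - u 1) with hq
  set r := gradient P.g (u 0 - u 1) with hr
  let e : Vec n := WithLp.toLp 2 fun _ => 1
  obtain ⟨κ, hκ0, hκ1, hκ2⟩ := exists_multiplier_of_lines (s := u 0 + u 1) (ξ := u 2)
    (v₀ := q + lam 0) (v₁ := -q + lam 1) (v₂ := lam 2 - P.γ • e) hu1 (by
      intro a b c habc
      have h1 := P.stationary_of_isMin_Z₁ hw (d := !₂[a, b, c]) (fun t => by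
        have := habc t
        change inner ℝ ((u 0 + t • a) + (u 1 + t • b)) (u 2 + t • c) = 0
        rw [← this]
        congr 1
        module)
      rw [Triple.inner_eq] at h1
      have h2 : inner ℝ e c = ∑ i, c i := by
        simp [e, PiLp.inner_apply]
      have h3 : inner ℝ q (a - b) - P.γ * ∑ i, c i +
        (inner ℝ (lam 0) a + inner ℝ (lam 1) b + inner ℝ (lam 2) c) = 0 := h1
      rw [inner_add_left, inner_add_left, inner_sub_left, inner_smul_left, inner_neg_left, h2]
      rw [inner_sub_right] at h3
      simp only [conj_trivial]
      linarith)
  -- The variational inequality says that `u` minimizes this linear form over the polyhedron `Z₂`,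
  -- so Farkas multipliers exist.
  let c : Pt n →ₗ[ℝ] ℝ :=
    (innerₛₗ ℝ r).comp ((PiLp.projₗ 2 (fun _ : Fin 3 => Vec n) 0 : Pt n →ₗ[ℝ] Vec n) -
      (PiLp.projₗ 2 (fun _ : Fin 3 => Vec n) 1 : Pt n →ₗ[ℝ] Vec n)) - innerₛₗ ℝ lam
  have hc : ∀ d : Pt n, c d = inner ℝ r (d 0 - d 1) - inner ℝ lam d := fun d => rfl
  let a : (Fin n ⊕ Fin n) ⊕ (Fin n ⊕ Fin n) ⊕ Fin m → Pt n →ₗ[ℝ] ℝ :=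
    Sum.elim (Sum.elim (coordForm 0) (coordForm 1))
      (Sum.elim (Sum.elim (coordForm 2) fun i => -coordForm 2 i) P.rowForm)
  let b : (Fin n ⊕ Fin n) ⊕ (Fin n ⊕ Fin n) ⊕ Fin m → ℝ :=
    Sum.elim (Sum.elim 0 0) (Sum.elim (Sum.elim 0 fun _ => -1) P.b)
  have hfeas : ∀ v : Pt n, (∀ i, b i ≤ a i v) ↔ v ∈ P.Z₂ := by
    intro v
    have hneg : ∀ i, (-coordForm 2 i : Pt n →ₗ[ℝ] ℝ) v = - v 2 i := fun i => rfl
    have hco : ∀ k i, (coordForm k i : Pt n →ₗ[ℝ] ℝ) v = v k i := fun k i => rfl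
    have hrow : ∀ j, P.rowForm j v = (P.A *ᵥ (v 0 - v 1).ofLp) j := fun j => rfl
    simp only [Sum.forall, a, b, Sum.elim_inl, Sum.elim_inr, Pi.zero_apply, hneg, hco, hrow,
      neg_le_neg_iff, Z₂]
    constructor
    · rintro ⟨⟨h0, h1⟩, ⟨h2, h3⟩, h4⟩
      exact ⟨fun i => ⟨h2 i, h3 i⟩, h0, h1, h4⟩
    · rintro ⟨h2, h0, h1, h4⟩
      exact ⟨⟨h0, h1⟩, ⟨fun i => (h2 i).1, fun i => (h2 i).2⟩, h4⟩
  obtain ⟨μ, hμ, hcomp, hceq⟩ := exists_multipliers_of_polyhedron a b c u ((hfeas u).2 hu2)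
    (fun v hv => by
      have := P.variational_ineq_of_isMin_Z₂ hg hu2 hy ((hfeas v).1 hv)
      rw [← sub_nonneg, ← map_sub, hc]
      exact this)
  have hval : ∀ d : Pt n, inner ℝ r (d 0 - d 1) - inner ℝ lam d =
      ∑ i, μ (.inl (.inl i)) * d 0 i + ∑ i, μ (.inl (.inr i)) * d 1 i +
      (∑ i, μ (.inr (.inl (.inl i))) * d 2 i + ∑ i, μ (.inr (.inl (.inr i))) * (- d 2 i) +
        ∑ j, μ (.inr (.inr j)) * (P.A *ᵥ (d 0 - d 1).ofLp) j) := by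
    intro d
    rw [← hc, hceq]
    simp only [LinearMap.sum_apply, LinearMap.smul_apply, smul_eq_mul]
    simp only [Fintype.sum_sum_type]
    rfl
  set π : Fin m → ℝ := fun j => μ (.inr (.inr j)) with hπ
  have hA : ∀ i, (P.Aᵀ *ᵥ π) i = ∑ j, μ (.inr (.inr j)) * P.A j i := by
    intro i
    simp only [Matrix.mulVec, dotProduct, Matrix.transpose_apply, hπ]
    exact Finset.sum_congr rfl fun j _ => mul_comm _ _
  -- Testing the identity of linear forms on unit vectors of each block yields the coordinate
  -- equations.
  have hv0 : ∀ i, r i - lam 0 i = μ (.inl (.inl i)) + (P.Aᵀ *ᵥ π) i := by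
    intro i
    have := hval !₂[EuclideanSpace.single i 1, 0, 0]
    rw [Triple.inner_eq] at this
    simpa [Pi.single_apply, hA, EuclideanSpace.inner_single_right] using this
  have hv1 : ∀ i, - r i - lam 1 i = μ (.inl (.inr i)) - (P.Aᵀ *ᵥ π) i := by
    intro i
    have := hval !₂[0, EuclideanSpace.single i 1, 0]
    rw [Triple.inner_eq] at this
    simpa [Pi.single_apply, hA, Matrix.mulVec_neg, Finset.sum_neg_distrib,
      sub_eq_add_neg, EuclideanSpace.inner_single_right] using this
  have hv2 : ∀ i, - lam 2 i = μ (.inr (.inl (.inl i))) - μ (.inr (.inl (.inr i))) := by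
    intro i
    have := hval !₂[0, 0, EuclideanSpace.single i 1]
    rw [Triple.inner_eq] at this
    simpa [Pi.single_apply, sub_eq_add_neg, EuclideanSpace.inner_single_right] using this
  have hκ0' : ∀ i, q i + lam 0 i = κ * u 2 i := fun i => congrArg (fun v : Vec n => v i) hκ0
  have hκ1' : ∀ i, - q i + lam 1 i = κ * u 2 i := fun i => congrArg (fun v : Vec n => v i) hκ1
  have hκ2' : ∀ i, lam 2 i - P.γ = κ * (u 0 i + u 1 i) := fun i => by
    have : lam 2 i - P.γ * 1 = κ * (u 0 i + u 1 i) := congrArg (fun v : Vec n => v i) hκ2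
    linarith
  have hgrad : ∀ i, gradient P.f (u 0 - u 1) i = q i + r i := fun i => by
    rw [P.gradient_f hg]; rfl
  obtain ⟨z2, z0, z1, zA⟩ := hu2
  -- Adding the `Z₁` and `Z₂` equations cancels `lam`. The sign of `κ` flips because the KKT system
  -- puts `μ ξ` on the same side as the gradient.
  refine ⟨-κ, fun i => μ (.inl (.inl i)), fun i => μ (.inl (.inr i)),
    fun i => μ (.inr (.inl (.inl i))), fun i => μ (.inr (.inl (.inr i))), π, fun i => ?_,
    fun i => ?_, fun i => ?_, ⟨fun i => hμ _, z0, fun i => ?_⟩, ⟨fun i => hμ _, z1, fun i => ?_⟩,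
    ⟨fun i => hμ _, fun i => (z2 i).1, fun i => ?_⟩,
    ⟨fun i => hμ _, fun i => sub_nonneg.2 (z2 i).2, fun i => ?_⟩,
    ⟨fun i => hμ _, fun j => sub_nonneg.2 (zA j), fun j => ?_⟩, hu1⟩
  · rw [hgrad]; linarith [hκ0' i, hv0 i]
  · rw [hgrad]; linarith [hκ1' i, hv1 i]
  · linarith [hκ2' i, hv2 i]
  · have : μ (.inl (.inl i)) * (u 0 i - 0) = 0 := hcomp (.inl (.inl i))
    linarith
  · have : μ (.inl (.inr i)) * (u 1 i - 0) = 0 := hcomp (.inl (.inr i))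
    linarith
  · have : μ (.inr (.inl (.inl i))) * (u 2 i - 0) = 0 := hcomp (.inr (.inl (.inl i)))
    linarith
  · have : μ (.inr (.inl (.inr i))) * (-u 2 i - -1) = 0 := hcomp (.inr (.inl (.inr i)))
    linarith
  · exact hcomp (.inr (.inr j))

end ProblemData

/-! ### Convergence of the whole sequence and stationarity of the limit -/

/-- An eventually non-increasing sequence converges to each of its subsequential limits, which
bounds it from below. -/
theorem tendsto_of_eventually_antitone {l : ℕ → ℝ} {L : ℝ} {K : ℕ} {σ : ℕ → ℕ}
    (hl : ∀ k ≥ K, l (k + 1) ≤ l k) (hσ : StrictMono σ)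
    (hL : Tendsto (fun j => l (σ j)) atTop (𝓝 L)) :
    Tendsto l atTop (𝓝 L) ∧ ∀ k ≥ K, L ≤ l k := by
  have hanti : ∀ k ≥ K, ∀ j ≥ k, l j ≤ l k := by
    intro k hk j hj
    induction j, hj using Nat.le_induction with
    | base => exact le_rfl
    | succ j hj ih => exact (hl j (hk.le.trans hj)).trans ih
  have hge : ∀ k ≥ K, L ≤ l k := by
    intro k hk
    refine le_of_tendsto hL ?_
    filter_upwards [hσ.tendsto_atTop.eventually_ge_atTop k] with j hj using hanti k hk _ hj
  refine ⟨tendsto_order.2 ⟨fun a ha => ?_, fun a ha => ?_⟩, hge⟩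
  · filter_upwards [eventually_ge_atTop K] with k hk using ha.trans_le (hge k hk)
  · obtain ⟨j, hj, hjK⟩ := ((hL.eventually (gt_mem_nhds ha)).and
      (hσ.tendsto_atTop.eventually_ge_atTop K)).exists
    filter_upwards [eventually_ge_atTop (σ j)] with k hk using (hanti _ hjK _ hk).trans_lt hj

namespace IsADMMSequence

variable {n m : ℕ} {P : ProblemData n m} {δ δρ ρmax : ℝ} {w y lam : ℕ → Pt n} {ρs : ℕ → ℝ}

/-- Once the penalty parameter is constant and controls the multipliers, the Kurdyka-Lojasiewicz
property at a cluster point forces finite length and convergence to that point. -/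
theorem summable_and_tendsto_of_KL (h : IsADMMSequence P δ δρ ρmax w y lam ρs)
    (hg : Continuous P.g) {K : ℕ} {ρ C a : ℝ} (hρ : 0 < ρ) (hC0 : 0 ≤ C) (ha : 0 < a)
    (hρK : ∀ k ≥ K, ρs k = ρ)
    (hC : ∀ k ≥ K, ‖lam (k + 1) - lam k‖ ≤ C * ‖y (k + 1) - y k‖)
    (hdec : ∀ k ≥ K + 1, P.augLag (w (k + 1)) (y (k + 1)) (lam (k + 1)) ρ +
      a * ‖y (k + 1) - y k‖ ^ 2 ≤ P.augLag (w k) (y k) (lam k) ρ)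
    (hylim : Tendsto (fun k => y (k + 1) - y k) atTop (𝓝 0))
    {zstar : Triple (Pt n)} {σ : ℕ → ℕ} (hσ : StrictMono σ)
    (hz : Tendsto (fun j => (!₂[w (σ j), y (σ j), lam (σ j)] : Triple (Pt n))) atTop (𝓝 zstar))
    (hKL : HasKLPropertyAt (P.H ρ) zstar) :
    (Summable fun k => ‖y (k + 1) - y k‖) ∧
      Tendsto (fun k => (!₂[w k, y k, lam k] : Triple (Pt n))) atTop (𝓝 zstar) := by
  obtain ⟨-, η, hη, U, hU, φ, hφc, hφ, hφnn, hφ0, -, hφ', hKL⟩ := hKL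
  set z : ℕ → Triple (Pt n) := fun k => !₂[w k, y k, lam k] with hzdef
  -- The tail is reindexed from `K + 1`, where iterates are feasible and each arises from a step
  -- with the final penalty. Dropping the first `K + 1` terms of `σ` makes the subtraction exact.
  set τ : ℕ → ℕ := fun j => σ (j + (K + 1)) - (K + 1) with hτdef
  have hσge : ∀ j, K + 1 ≤ σ (j + (K + 1)) := fun j =>
    (Nat.le_add_left _ _).trans (hσ.id_le (j + (K + 1)))
  have hτadd : ∀ j, K + τ j + 1 = σ (j + (K + 1)) := fun j => by
    have := hσge j
    simp only [hτdef]; omega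
  have hτ : StrictMono τ := fun i j hij => by
    have h1 := hσ (show i + (K + 1) < j + (K + 1) by omega)
    have h2 := hτadd i
    have h3 := hτadd j
    omega
  have hzτ : Tendsto (fun j => z (K + τ j + 1)) atTop (𝓝 zstar) := by
    simp only [hτadd]
    exact hz.comp (tendsto_add_atTop_nat (K + 1))
  obtain ⟨hzτ0, hzτ1, hzτ2⟩ := Triple.tendsto_iff.1 hzτ
  have hmem1 : zstar 0 ∈ P.Z₁ := by
    refine P.isClosed_Z₁.mem_of_tendsto hzτ0 ?_
    exact Eventually.of_forall fun j => h.w_mem _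
  have hmem2 : zstar 1 ∈ P.Z₂ := by
    refine P.isClosed_Z₂.mem_of_tendsto hzτ1 ?_
    exact Eventually.of_forall fun j => h.y_mem _
  set l : ℕ → ℝ := fun k => P.augLag (w (K + k + 1)) (y (K + k + 1)) (lam (K + k + 1)) ρ with hldef
  set L := P.augLag (zstar 0) (zstar 1) (zstar 2) ρ with hLdef
  set D : ℕ → ℝ := fun k => ‖y (K + k + 1) - y (K + k)‖ with hDdef
  have hD0 : ∀ k, 0 ≤ D k := fun k => norm_nonneg _
  have hDlim : Tendsto D atTop (𝓝 0) := by
    have := (hylim.comp (tendsto_add_atTop_nat K)).norm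
    rw [norm_zero] at this
    refine this.congr fun k => ?_
    simp only [hDdef, Function.comp_apply, add_comm K k]
  have hldec : ∀ k, l (k + 1) + a * D (k + 1) ^ 2 ≤ l k := fun k =>
    hdec (K + k + 1) (by omega)
  have hlτ : Tendsto (fun j => l (τ j)) atTop (𝓝 L) :=
    P.tendsto_augLag hg ρ hzτ0 hzτ1 hzτ2
  obtain ⟨hlL, hLl⟩ := tendsto_of_eventually_antitone (K := 0)
    (fun k _ => by have := hldec k; have : 0 ≤ a * D (k + 1) ^ 2 := by positivity
                   linarith) hτ hlτ
  have hdist : ∀ k, dist (z (K + k + 1)) (z (K + (k + 1) + 1)) ≤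
      (2 + C + C / ρ) * (D k + D (k + 1)) := by
    intro k
    have hr0 : 0 < ρs (K + k) := by rw [hρK _ (by omega)]; exact hρ
    have hr1 : 0 < ρs (K + (k + 1)) := by rw [hρK _ (by omega)]; exact hρ
    have e0 := h.w_sub_y hr0
    have e1 := h.w_sub_y hr1
    rw [hρK _ (by omega)] at e0 e1
    have hlam0 := hC (K + k) (by omega)
    have hlam1 := hC (K + (k + 1)) (by omega)
    -- Substituting `w = y + Δλ / ρ` at both indices; two multiplier steps appear, hence two
    -- consecutive `D`.
    have e2 : w (K + (k + 1) + 1) - w (K + k + 1) = (y (K + (k + 1) + 1) - y (K + (k + 1))) +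
        ρ⁻¹ • ((lam (K + (k + 1) + 1) - lam (K + (k + 1))) - (lam (K + k + 1) - lam (K + k))) := by
      rw [smul_sub, ← e0, ← e1, ← add_assoc K k 1]
      abel
    have e3 : ‖w (K + (k + 1) + 1) - w (K + k + 1)‖ ≤
        D (k + 1) + ρ⁻¹ * (C * D (k + 1) + C * D k) := by
      rw [e2]
      refine (norm_add_le _ _).trans ?_
      rw [norm_smul, norm_inv, Real.norm_of_nonneg hρ.le]
      refine add_le_add le_rfl (mul_le_mul_of_nonneg_left ?_ (inv_nonneg.2 hρ.le))
      exact (norm_sub_le _ _).trans (add_le_add hlam1 hlam0)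
    rw [dist_comm, dist_eq_norm]
    refine (Triple.norm_le _).trans ?_
    have e4 : ‖y (K + (k + 1) + 1) - y (K + k + 1)‖ = D (k + 1) := rfl
    have e5 : ‖lam (K + (k + 1) + 1) - lam (K + k + 1)‖ ≤ C * D (k + 1) := hlam1
    have e6 : ‖w (K + (k + 1) + 1) - w (K + k + 1)‖ + ‖y (K + (k + 1) + 1) - y (K + k + 1)‖ +
        ‖lam (K + (k + 1) + 1) - lam (K + k + 1)‖ ≤ (2 + C + C / ρ) * (D k + D (k + 1)) := by
      have e7 : ρ⁻¹ * (C * D (k + 1) + C * D k) = C / ρ * (D k + D (k + 1)) := by ring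
      have e8 := mul_nonneg hC0 (hD0 k)
      have e9 := hD0 k
      rw [e7] at e3
      linarith
    exact e6
  have hsum : Summable D := by
    refine summable_of_desingularizing (z := fun k => z (K + k + 1)) (c := 2 * C + ρ + C / ρ)
      hD0 hDlim ha (by positivity) (by positivity) (fun k => hLl k (Nat.zero_le k)) hlL hldec hdist
      hτ hzτ hη hU hφc hφ hφ0 hφnn hφ' fun k hkU hk1 hk2 => ?_
    have hHstar : P.H ρ zstar = (L : EReal) := P.H_of_mem hmem1 hmem2
    have hHk : P.H ρ (z (K + k + 1)) = (l k : EReal) := P.H_of_mem (h.w_mem _) (h.y_mem _)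
    have key := hKL _ hkU (by rw [hHstar, hHk]; exact_mod_cast hk1)
      (by rw [hHstar, hHk]; exact_mod_cast hk2)
    have hr0 : 0 < ρs (K + k) := by rw [hρK _ (by omega)]; exact hρ
    have hdst := h.infEDist_limitingSubdiff_le hr0 (hC (K + k) (by omega))
    rw [hρK _ (by omega)] at hdst
    rw [hHstar, hHk, ← EReal.coe_sub, EReal.toReal_coe] at key
    have hder : 0 < deriv φ (l k - L) := hφ' _ ⟨by linarith, by linarith⟩
    have := key.trans (mul_le_mul_right hdst _)
    rw [← ENNReal.ofReal_mul hder.le, ENNReal.one_le_ofReal] at this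
    exact this
  have hsumy : Summable fun k => ‖y (k + 1) - y k‖ := by
    refine (summable_nat_add_iff K).1 (hsum.congr fun k => ?_)
    simp only [hDdef, add_comm K k]
  refine ⟨hsumy, ?_⟩
  have hcauchy : CauchySeq fun k => z (K + k + 1) :=
    cauchySeq_of_dist_le_of_summable _ hdist
      ((hsum.add ((summable_nat_add_iff 1).2 hsum)).mul_left _)
  have hconv := tendsto_nhds_of_cauchySeq_of_subseq hcauchy hτ.tendsto_atTop hzτ
  refine (tendsto_add_atTop_iff_nat (K + 1)).1 (hconv.congr fun k => ?_)
  rw [show k + (K + 1) = K + k + 1 by ring]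

/-- A limit of the whole sequence with `y k - w k → 0` is a KKT point. -/
theorem isKKT_of_tendsto (h : IsADMMSequence P δ δρ ρmax w y lam ρs) (hg : ContDiff ℝ 1 P.g)
    {ρ : ℝ} (hρK : ∀ᶠ k in atTop, ρs k = ρ) {zstar : Triple (Pt n)}
    (hz : Tendsto (fun k => (!₂[w k, y k, lam k] : Triple (Pt n))) atTop (𝓝 zstar))
    (hyw : Tendsto (fun k => y k - w k) atTop (𝓝 0)) : P.IsKKT (zstar 0) := by
  obtain ⟨hw, hy, hl⟩ := Triple.tendsto_iff.1 hz
  have hw1 := hw.comp (tendsto_add_atTop_nat 1)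
  have hy1 := hy.comp (tendsto_add_atTop_nat 1)
  have heq : zstar 1 = zstar 0 := sub_eq_zero.1 (tendsto_nhds_unique (hy.sub hw) hyw)
  rw [heq] at hy hy1
  have hmem1 : zstar 0 ∈ P.Z₁ :=
    P.isClosed_Z₁.mem_of_tendsto hw1 (Eventually.of_forall fun k => h.w_mem k)
  have hmem2 : zstar 0 ∈ P.Z₂ :=
    P.isClosed_Z₂.mem_of_tendsto hy1 (Eventually.of_forall fun k => h.y_mem k)
  refine P.isKKT_of_isMin (hg.differentiable one_ne_zero) (lam := zstar 2) (ρ := ρ) hmem1 hmem2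
    (fun w' hw' => ?_) fun y' hy' => ?_
  -- The competitor is fixed and the Lagrangian continuous, so global minimality passes to the
  -- limit. Here `w` is taken at `k + 1` against `y` and `lam` at `k`.
  · refine le_of_tendsto_of_tendsto (P.tendsto_augLag hg.continuous ρ hw1 hy hl)
      (P.tendsto_augLag hg.continuous ρ tendsto_const_nhds hy hl) ?_
    filter_upwards [hρK] with k hk
    have := h.w_min k w' hw'
    rwa [hk] at this
  · refine le_of_tendsto_of_tendsto (P.tendsto_augLag hg.continuous ρ hw1 hy1 hl)
      (P.tendsto_augLag hg.continuous ρ hw1 tendsto_const_nhds hl) ?_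
    filter_upwards [hρK] with k hk
    have := h.y_min k y' hy'
    rwa [hk] at this

end IsADMMSequence

/-! ### Assembly of the convergence theorem -/

theorem mainTheorem3 {n m : ℕ} (P : ProblemData n m)
    (hM : P.M.IsSymm) (hγ : 0 < P.γ)
    (hg_convex : ConvexOn ℝ Set.univ P.g) (hg_smooth : ContDiff ℝ 1 P.g)
    (δ δρ ρmax : ℝ) (w y lam : ℕ → Pt n) (ρs : ℕ → ℝ)
    (hseq : IsADMMSequence P δ δρ ρmax w y lam ρs)
    (hρ : ∀ k, ρs k ≤ ρmax)
    (hlam : Filter.liminf (fun k => ‖lam k‖ₑ) Filter.atTop < ⊤)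
    (hy : Bornology.IsBounded (Set.range y)) :
    ∃ (K₀ : ℕ) (ρ C : ℝ), C = (ρ - δ) / √2 ∧
      -- the penalty parameter is eventually constant and controls the multipliers
      (∀ k ≥ K₀, ρs k = ρ) ∧
      (∀ k ≥ K₀, ‖lam (k + 1) - lam k‖ ≤ C * ‖y (k + 1) - y k‖) ∧
      -- descent of the augmented Lagrangian
      AntitoneOn (fun k => P.augLag (w k) (y k) (lam k) (ρs k)) (Set.Ici K₀) ∧
      (∀ k ≥ K₀,
        P.augLag (w (k + 1)) (y (k + 1)) (lam (k + 1)) ρ - P.augLag (w k) (y k) (lam k) ρ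
            ≤ (C ^ 2 / ρ - ρ / 2) * ‖y (k + 1) - y k‖ ^ 2 ∧
        (C ^ 2 / ρ - ρ / 2) * ‖y (k + 1) - y k‖ ^ 2 ≤ -(δ / 2) * ‖y (k + 1) - y k‖ ^ 2) ∧
      -- lower bound, asymptotic regularity, boundedness and a convergent subsequence
      BddBelow ((fun k => P.augLag (w k) (y k) (lam k) (ρs k)) '' Set.Ici K₀) ∧
      Filter.Tendsto (fun k => y (k + 1) - y k) Filter.atTop (nhds 0) ∧
      Filter.Tendsto (fun k => y k - w k) Filter.atTop (nhds 0) ∧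
      Bornology.IsBounded (Set.range w) ∧
      (∃ (zstar : Triple (Pt n)) (φ : ℕ → ℕ), StrictMono φ ∧
        Filter.Tendsto (fun j => (!₂[w (φ j), y (φ j), lam (φ j)] : Triple (Pt n)))
          Filter.atTop (nhds zstar)) ∧
      -- at every subsequential limit with the Kurdyka-Lojasiewicz property
      (∀ (zstar : Triple (Pt n)) (φ : ℕ → ℕ), StrictMono φ →
        Filter.Tendsto (fun j => (!₂[w (φ j), y (φ j), lam (φ j)] : Triple (Pt n)))
          Filter.atTop (nhds zstar) →
        HasKLPropertyAt (P.H ρ) zstar →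
          (Summable fun k => ‖y (k + 1) - y k‖) ∧
          Filter.Tendsto (fun k => (!₂[w k, y k, lam k] : Triple (Pt n)))
            Filter.atTop (nhds zstar) ∧
          P.IsKKT (zstar 0)) := by
  obtain ⟨hρ0, K, hK⟩ := eventually_const_of_bounded_increase hseq.one_lt_δρ hseq.ρ_zero_pos
    hseq.ρ_succ hρ
  set ρ := ρs K with hρdef
  have hδρ : δ < ρ := hseq.δ_lt.trans_le (hρ0 K)
  have hδ := hseq.δ_pos
  have hρpos : 0 < ρ := hδ.trans hδρ
  have hρK : ∀ k ≥ K, ρs k = ρ := fun k hk => (hK k hk).1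
  set C := (ρ - δ) / √2 with hCdef
  have h2 : 0 < √(2 : ℝ) := by positivity
  have hC0 : 0 ≤ C := div_nonneg (by linarith) h2.le
  have hC : ∀ k ≥ K, ‖lam (k + 1) - lam k‖ ≤ C * ‖y (k + 1) - y k‖ := by
    intro k hk
    have := (hK k hk).2
    rw [not_and', hρK k hk] at this
    have := not_lt.1 (this (by rw [← hρK k hk]; exact hρ k))
    rw [hCdef, div_mul_eq_mul_div, le_div_iff₀ h2]
    linarith
  -- The starting points need not be feasible, so if `K = 0` descent can be claimed only from `K +
  -- 1`.
  have hmem : ∀ k ≥ K + 1, w k ∈ P.Z₁ ∧ y k ∈ P.Z₂ := by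
    intro k hk
    obtain ⟨j, rfl⟩ : ∃ j, k = j + 1 := ⟨k - 1, by omega⟩
    exact ⟨hseq.w_mem j, hseq.y_mem j⟩
  -- Since `C² = (ρ - δ)² / 2`, this amounts to `(ρ - δ)² ≤ ρ (ρ - δ)`.
  have hcoef : C ^ 2 / ρ - ρ / 2 ≤ -(δ / 2) := by
    have e1 : C ^ 2 = (ρ - δ) ^ 2 / 2 := by
      rw [hCdef, div_pow, Real.sq_sqrt (by norm_num)]
    have e2 : C ^ 2 / ρ ≤ ρ / 2 - δ / 2 := by
      rw [div_le_iff₀ hρpos, e1]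
      nlinarith [mul_pos hδ (sub_pos.2 hδρ)]
    linarith
  have hdesc : ∀ k ≥ K + 1,
      P.augLag (w (k + 1)) (y (k + 1)) (lam (k + 1)) ρ - P.augLag (w k) (y k) (lam k) ρ
        ≤ (C ^ 2 / ρ - ρ / 2) * ‖y (k + 1) - y k‖ ^ 2 := by
    intro k hk
    have hkK : k ≥ K := by omega
    have e1 := hseq.augLag_succ_le hg_convex (by rw [hρK k hkK]; exact hρpos)
      (hmem k hk).1 (hmem k hk).2
    rw [hρK k hkK] at e1
    have e2 : ‖lam (k + 1) - lam k‖ ^ 2 / ρ ≤ C ^ 2 / ρ * ‖y (k + 1) - y k‖ ^ 2 := by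
      rw [div_mul_eq_mul_div, ← mul_pow]
      gcongr
      exact hC k hkK
    linarith
  have hdesc' : ∀ k, (C ^ 2 / ρ - ρ / 2) * ‖y (k + 1) - y k‖ ^ 2 ≤
      -(δ / 2) * ‖y (k + 1) - y k‖ ^ 2 := fun k =>
    mul_le_mul_of_nonneg_right hcoef (sq_nonneg _)
  have hdec : ∀ k ≥ K + 1, P.augLag (w (k + 1)) (y (k + 1)) (lam (k + 1)) ρ +
      δ / 2 * ‖y (k + 1) - y k‖ ^ 2 ≤ P.augLag (w k) (y k) (lam k) ρ := fun k hk => by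
    linarith [hdesc k hk, hdesc' k]
  have hmono : ∀ k ≥ K + 1, P.augLag (w (k + 1)) (y (k + 1)) (lam (k + 1)) ρ ≤
      P.augLag (w k) (y k) (lam k) ρ := fun k hk => by
    have : 0 ≤ δ / 2 * ‖y (k + 1) - y k‖ ^ 2 := by positivity
    linarith [hdec k hk]
  obtain ⟨R, hR⟩ := hy.exists_norm_le
  have hyR : ∀ k, ‖y k‖ ≤ R := fun k => hR _ (mem_range_self k)
  have hwy : ∀ k ≥ K, ‖w (k + 1) - y (k + 1)‖ ≤ ρ⁻¹ * (C * ‖y (k + 1) - y k‖) := by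
    intro k hk
    rw [hseq.w_sub_y (by rw [hρK k hk]; exact hρpos), hρK k hk, norm_smul, norm_inv,
      Real.norm_of_nonneg hρpos.le]
    exact mul_le_mul_of_nonneg_left (hC k hk) (inv_nonneg.2 hρpos.le)
  have hwbd : Bornology.IsBounded (Set.range w) := by
    have hsub : Set.range w ⊆ w '' Set.Iic K ∪
        Metric.closedBall 0 (R + ρ⁻¹ * (C * (R + R))) := by
      rintro _ ⟨k, rfl⟩
      by_cases hk : k ≤ K
      · exact Or.inl ⟨k, hk, rfl⟩
      · right
        obtain ⟨j, rfl⟩ : ∃ j, k = j + 1 := ⟨k - 1, by omega⟩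
        rw [mem_closedBall_zero_iff]
        have e1 : ‖y (j + 1) - y j‖ ≤ R + R :=
          (norm_sub_le _ _).trans (add_le_add (hyR _) (hyR _))
        have e2 : ρ⁻¹ * (C * ‖y (j + 1) - y j‖) ≤ ρ⁻¹ * (C * (R + R)) := by gcongr
        have e3 : ‖w (j + 1)‖ ≤ ‖y (j + 1)‖ + ‖w (j + 1) - y (j + 1)‖ := by
          simpa using norm_add_le (y (j + 1)) (w (j + 1) - y (j + 1))
        linarith [hwy j (by omega), hyR (j + 1)]
    exact (((Set.finite_Iic K).image w).isBounded.union Metric.isBounded_closedBall).subset hsub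
  have hsubseq : ∃ (zstar : Triple (Pt n)) (φ : ℕ → ℕ), StrictMono φ ∧
      Filter.Tendsto (fun j => (!₂[w (φ j), y (φ j), lam (φ j)] : Triple (Pt n)))
        Filter.atTop (nhds zstar) := by
    obtain ⟨R₁, hR₁⟩ := exists_frequently_norm_le_of_liminf_lt_top hlam
    obtain ⟨R₂, hR₂⟩ := hwbd.exists_norm_le
    obtain ⟨a, -, φ, hφ, hlim⟩ := tendsto_subseq_of_frequently_bounded
      (Metric.isBounded_closedBall (x := (0 : Triple (Pt n))) (r := R₂ + R + R₁))
      (x := fun k => (!₂[w k, y k, lam k] : Triple (Pt n))) (hR₁.mono fun k hk => by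
        rw [mem_closedBall_zero_iff]
        exact (Triple.norm_le _).trans
          (add_le_add (add_le_add (hR₂ _ (mem_range_self k)) (hyR k)) hk))
    exact ⟨a, φ, hφ, hlim⟩
  obtain ⟨z₀, φ₀, hφ₀, hz₀⟩ := hsubseq
  obtain ⟨hz₀0, hz₀1, hz₀2⟩ := Triple.tendsto_iff.1 hz₀
  -- The energy at a single cluster point is already a lower bound for the whole tail; the full
  -- multiplier sequence need not be known to be bounded.
  obtain ⟨hLlim, hLle⟩ := tendsto_of_eventually_antitone
    (l := fun k => P.augLag (w k) (y k) (lam k) ρ) hmono hφ₀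
    (P.tendsto_augLag hg_smooth.continuous ρ hz₀0 hz₀1 hz₀2)
  have hylim : Filter.Tendsto (fun k => y (k + 1) - y k) Filter.atTop (nhds 0) := by
    rw [tendsto_zero_iff_norm_tendsto_zero]
    have e1 := (hLlim.sub (hLlim.comp (tendsto_add_atTop_nat 1))).const_mul (2 / δ)
    rw [sub_self, mul_zero] at e1
    have e2 : Tendsto (fun k => ‖y (k + 1) - y k‖ ^ 2) atTop (𝓝 0) := by
      refine squeeze_zero' (Eventually.of_forall fun k => sq_nonneg _) ?_ e1
      filter_upwards [eventually_ge_atTop (K + 1)] with k hk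
      have e3 := hdec k hk
      have e4 : ‖y (k + 1) - y k‖ ^ 2 = 2 / δ * (δ / 2 * ‖y (k + 1) - y k‖ ^ 2) := by
        field_simp
      rw [e4]
      refine mul_le_mul_of_nonneg_left ?_ (by positivity)
      simp only [Function.comp_apply]
      linarith
    simpa [Real.sqrt_sq (norm_nonneg _)] using e2.sqrt
  have hywlim : Filter.Tendsto (fun k => y k - w k) Filter.atTop (nhds 0) := by
    rw [← tendsto_add_atTop_iff_nat 1, tendsto_zero_iff_norm_tendsto_zero]
    have e1 := (hylim.norm.const_mul C).const_mul ρ⁻¹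
    rw [norm_zero, mul_zero, mul_zero] at e1
    refine squeeze_zero' (Eventually.of_forall fun k => norm_nonneg _) ?_ e1
    filter_upwards [eventually_ge_atTop K] with k hk
    rw [norm_sub_rev]
    exact hwy k hk
  refine ⟨K + 1, ρ, C, rfl, fun k hk => hρK k (by omega), fun k hk => hC k (by omega), ?_,
    fun k hk => ⟨hdesc k hk, hdesc' k⟩, ?_, hylim, hywlim, hwbd, ⟨z₀, φ₀, hφ₀, hz₀⟩, ?_⟩
  · intro i hi j hj hij
    have hi' : K + 1 ≤ i := hi
    dsimp only
    rw [hρK i (by omega), hρK j (le_trans (by omega) hij)]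
    clear hj
    induction j, hij using Nat.le_induction with
    | base => exact le_rfl
    | succ j hij ih => exact (hmono j (hi'.trans hij)).trans ih
  · refine ⟨P.augLag (z₀ 0) (z₀ 1) (z₀ 2) ρ, ?_⟩
    rintro _ ⟨k, hk, rfl⟩
    have hk' : K + 1 ≤ k := hk
    dsimp only
    rw [hρK k (by omega)]
    exact hLle k hk'
  · intro zstar φ hφ hz hKL
    obtain ⟨hsum, hconv⟩ := hseq.summable_and_tendsto_of_KL hg_smooth.continuous hρpos hC0
      (half_pos hδ) hρK hC hdec hylim hφ hz hKL
    exact ⟨hsum, hconv, hseq.isKKT_of_tendsto hg_smooth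
      (eventually_atTop.2 ⟨K, hρK⟩) hconv hywlim⟩
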